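/- **Setting.** Let $\mathbf V$ be a compact Hausdorff smooth manifold of dimension $n+m$ with an N-connection, that is, a smooth splitting $T\mathbf V=h\mathbf V\oplus v\mathbf V$ in which the vertical distribution $v\mathbf V$ is, near every point, the kernel of the differential of a submersion to $\mathbb R^n$. Let $\mathbf g$ be a Riemannian d-metric on $\mathbf V$ (a smooth Riemannian metric for which $h\mathbf V\perp v\mathbf V$), with volume measure $\mu$. Let $(U_\alpha)_{\alpha\in I}$ be an open covering of $\mathbf V$. For every $\alpha$ let $e_\alpha$ be a smooth real vector bundle over $U_\alpha$ with finite-dimensional typical fibre $Q$ (for instance an object over $U_\alpha$ of an N-anholonomic vector gerbe), with a Riemannian d-metric: a smooth fibrewise scalar product and a smooth orthogonal splitting $e_\alpha=he_\alpha\oplus ve_\alpha$. Let $q_{\alpha\beta}:e_\beta|_{U_\alpha\cap U_\beta}\to e_\alpha|_{U_\alpha\cap U_\beta}$ be smooth bundle isomorphisms preserving the scalar products and the splittings (no cocycle condition is required). Let $\mathbf Z(q_{\alpha\beta})$ be the real vector space of all families $z=(z_\alpha)_{\alpha\in I}$ of smooth sections $z_\alpha$ of $e_\alpha$ with $z_\alpha=q_{\alpha\beta}(z_\beta)$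 on $U_\alpha\cap U_\beta$ for all $\alpha,\beta$. Let $(f_{\alpha'})_{\alpha'\in I'}$ be a smooth partition of unity on $\mathbf V$ with $\operatorname{supp} f_{\alpha'}\subset U_{\alpha(\alpha')}$ for a map $\alpha'\mapsto\alpha(\alpha')$ from $I'$ to $I$. For two families of sections put $$\langle z,w\rangle=\sum_{\alpha'\in I'}\int_{U_{\alpha(\alpha')}}\langle f_{\alpha'}z_{\alpha(\alpha')},f_{\alpha'}w_{\alpha(\alpha')}\rangle\,d\mu .$$ This is a scalar product on $\mathbf Z(q_{\alpha\beta})$; let $L^2(\mathbf Z(q_{\alpha\beta}))$ be the Hilbert completion. **Proposition.** Every element of $L^2(\mathbf Z(q_{\alpha\beta}))$ is an N-adapted family $(\mathbf z_\alpha)_{\alpha\in I}$ of $L^2$ sections $\mathbf z_\alpha$ of $e_\alpha$ such that $\mathbf z_\alpha=q_{\alpha\beta}(\mathbf z_\beta)$ almost everywhere on $U_\alpha\cap U_\beta$. Precisely, there is a map $T$, unique up to equality almost everywhere, which sends each $\zeta\in L^2(\mathbf Z(q_{\alpha\beta}))$ to a family $T\zeta=((T\zeta)_\alpha)_{\alpha\in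 I}$ such that: 1. for every $\zeta$, each $(T\zeta)_\alpha$ is an $L^2$ section of $e_\alpha$ over $U_\alpha$, and $(T\zeta)_\alpha=q_{\alpha\beta}((T\zeta)_\beta)$ almost everywhere on $U_\alpha\cap U_\beta$ for all $\alpha,\beta$; 2. $Tz=z$ almost everywhere for $z\in\mathbf Z(q_{\alpha\beta})$; $T$ is linear modulo equality almost everywhere; and $\langle\zeta,\eta\rangle=\langle T\zeta,T\eta\rangle$ for all $\zeta,\eta$, where the right-hand side is given by the formula above (so $T$ is injective modulo equality almost everywhere). Moreover $T$ is N-adapted: there are continuous linear operators $h,v$ on $L^2(\mathbf Z(q_{\alpha\beta}))$ with $h\zeta+v\zeta=\zeta$ and $\langle h\zeta,v\eta\rangle=0$ such that $T(h\zeta)$ and $T(v\zeta)$ are, almost everywhere, the families of the $he_\alpha$-components and of the $ve_\alpha$-components of $T\zeta$; and $\langle\zeta,\eta\rangle$ is the sum of the scalar products of the h-components and of the v-components of $T\zeta$ and $T\eta$. -/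

import Mathlib

open Set Filter Topology MeasureTheory Manifold Bundle TopologicalSpace
open scoped ContDiff ENNReal

set_option linter.unusedSectionVars false

noncomputable section

namespace NGerbe

/-- Coordinates `u = (x^i, y^a)` with `n` horizontal and `m` vertical entries. -/
abbrev Coord (n m : ℕ) : Type := EuclideanSpace ℝ (Fin n ⊕ Fin m)

section Base

variable (n m : ℕ) (V : Type*) [TopologicalSpace V] [ChartedSpace (Coord n m) V]
  [IsManifold 𝓘(ℝ, Coord n m) ∞ V]

/-- An N-connection on `V`: a smooth splitting `TV = hV ⊕ vV`, given by the projection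
`ver : TV → vV` of `TV` onto `vV`, which is the identity on `vV`. The vertical distribution `vV`
is, near each point, the kernel of the differential of a submersion onto an open subset of
`ℝ^n`; in particular `vV` has rank `m`. The horizontal distribution `hV = ker ver` is arbitrary
(in general nonintegrable). -/
structure NConnection where
  /-- The value at `x` is the projection of `T_x V` onto the vertical subspace. -/
  ver : ∀ x : V, TangentSpace 𝓘(ℝ, Coord n m) x →L[ℝ] TangentSpace 𝓘(ℝ, Coord n m) x
  idem : ∀ (x : V) (X : TangentSpace 𝓘(ℝ, Coord n m) x), ver x (ver x X) = ver x X
  smooth :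
    ContMDiff (𝓘(ℝ, Coord n m).prod 𝓘(ℝ, Coord n m)) (𝓘(ℝ, Coord n m).prod 𝓘(ℝ, Coord n m)) ∞
      (fun X : TotalSpace (Coord n m) (TangentSpace 𝓘(ℝ, Coord n m) : V → Type _) =>
        (⟨X.proj, ver X.proj X.2⟩ :
          TotalSpace (Coord n m) (TangentSpace 𝓘(ℝ, Coord n m) : V → Type _)))
  submersion : ∀ u : V, ∃ W : Opens V, u ∈ W ∧ ∃ pr : V → EuclideanSpace ℝ (Fin n),
    ContMDiffOn 𝓘(ℝ, Coord n m) 𝓘(ℝ, EuclideanSpace ℝ (Fin n)) ∞ pr W ∧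
    ∀ x ∈ W, Function.Surjective
        (mfderiv 𝓘(ℝ, Coord n m) 𝓘(ℝ, EuclideanSpace ℝ (Fin n)) pr x) ∧
      ∀ X : TangentSpace 𝓘(ℝ, Coord n m) x,
        mfderiv 𝓘(ℝ, Coord n m) 𝓘(ℝ, EuclideanSpace ℝ (Fin n)) pr x X = 0 ↔ ver x X = X

variable {n m V}

/-- A Riemannian d-metric: a smooth Riemannian metric on `V` for which `hV` and `vV` are
orthogonal, so that it is the sum of its h- and v-components. -/
structure DMetric (N : NConnection n m V) extends
    ContMDiffRiemannianMetric 𝓘(ℝ, Coord n m) ∞ (Coord n m)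
      (TangentSpace 𝓘(ℝ, Coord n m) : V → Type _) where
  hv_orthogonal : ∀ (x : V) (X Y : TangentSpace 𝓘(ℝ, Coord n m) x),
    inner x (N.ver x X) (Y - N.ver x Y) = 0

variable {N : NConnection n m V} (g : DMetric N)

variable (n m) in
/-- The coordinate frame of the chart at `p`: `coordFrame p y` sends the `α`-th basis vector to
the coordinate vector `∂_α` at the point with coordinates `y`. -/
def coordFrame (p : V) (y : Coord n m) :
    Coord n m →L[ℝ] TangentSpace 𝓘(ℝ, Coord n m) ((extChartAt 𝓘(ℝ, Coord n m) p).symm y) :=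
  mfderiv 𝓘(ℝ, Coord n m) 𝓘(ℝ, Coord n m) (extChartAt 𝓘(ℝ, Coord n m) p).symm y

/-- The matrix `g(∂_α, ∂_β)` of the metric in the chart at `p`. -/
def gram (p : V) (y : Coord n m) : Matrix (Fin n ⊕ Fin m) (Fin n ⊕ Fin m) ℝ :=
  Matrix.of fun i j => g.inner ((extChartAt 𝓘(ℝ, Coord n m) p).symm y)
    (coordFrame n m p y (EuclideanSpace.single i 1)) (coordFrame n m p y (EuclideanSpace.single j 1))

lemma mfderiv_symm_eq (p : V) {y : Coord n m}
    (hy : y ∈ (extChartAt 𝓘(ℝ, Coord n m) p).target) :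
    (trivializationAt (Coord n m) (TangentSpace 𝓘(ℝ, Coord n m) : V → Type _) p).symmL ℝ
        ((extChartAt 𝓘(ℝ, Coord n m) p).symm y) =
      coordFrame n m p y := by
  have hx : (extChartAt 𝓘(ℝ, Coord n m) p).symm y ∈ (chartAt (Coord n m) p).source := by
    rw [← extChartAt_source 𝓘(ℝ, Coord n m)]
    exact (extChartAt 𝓘(ℝ, Coord n m) p).map_target hy
  have := TangentBundle.symmL_trivializationAt (I := 𝓘(ℝ, Coord n m)) hx
  rw [this, (extChartAt 𝓘(ℝ, Coord n m) p).right_inv hy]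
  simp only [modelWithCornersSelf_coe, range_id, mfderivWithin_univ]
  rfl

lemma gram_continuousOn (p : V) (i j : Fin n ⊕ Fin m) :
    ContinuousOn (fun y => gram g p y i j) (extChartAt 𝓘(ℝ, Coord n m) p).target := by
  set e := trivializationAt (Coord n m) (TangentSpace 𝓘(ℝ, Coord n m) : V → Type _) p with he
  have key : ContinuousOn (fun x : V => g.inner x
      (e.symmL ℝ x (EuclideanSpace.single i (1 : ℝ))) (e.symmL ℝ x (EuclideanSpace.single j (1 : ℝ))))
      e.baseSet := by
    have hs : ∀ k : Fin n ⊕ Fin m, ContMDiffOn 𝓘(ℝ, Coord n m)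
        (𝓘(ℝ, Coord n m).prod 𝓘(ℝ, Coord n m)) ∞
        (fun x : V => (⟨x, e.symmL ℝ x (EuclideanSpace.single k (1 : ℝ))⟩ :
          TotalSpace (Coord n m) (TangentSpace 𝓘(ℝ, Coord n m) : V → Type _))) e.baseSet := by
      intro k
      have := e.contMDiffOn_localFrame_baseSet (I := 𝓘(ℝ, Coord n m)) (n := ∞)
        (b := (EuclideanSpace.basisFun (Fin n ⊕ Fin m) ℝ).toBasis) k
      refine this.congr fun x hx => ?_
      rw [e.localFrame_apply_of_mem_baseSet _ hx]
      simp [Trivialization.basisAt]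
      exact e.symmL_apply hx _
    intro x hx
    have : ContMDiffWithinAt 𝓘(ℝ, Coord n m) (𝓘(ℝ, Coord n m).prod 𝓘(ℝ)) ∞
      (fun x ↦ TotalSpace.mk' ℝ (E := Bundle.Trivial V ℝ) x (g.inner x
      (e.symmL ℝ x (EuclideanSpace.single i (1 : ℝ)))
      (e.symmL ℝ x (EuclideanSpace.single j (1 : ℝ))))) e.baseSet x := by
      apply ContMDiffWithinAt.clm_bundle_apply₂ (F₁ := Coord n m) (F₂ := Coord n m)
      · exact g.contMDiff.contMDiffAt.contMDiffWithinAt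
      · exact hs i x hx
      · exact hs j x hx
    simp only [contMDiffWithinAt_totalSpace] at this
    exact this.2.continuousWithinAt
  have hmaps : MapsTo (extChartAt 𝓘(ℝ, Coord n m) p).symm
      (extChartAt 𝓘(ℝ, Coord n m) p).target e.baseSet := by
    intro y hy
    rw [he, TangentBundle.trivializationAt_baseSet, ← extChartAt_source 𝓘(ℝ, Coord n m)]
    exact (extChartAt 𝓘(ℝ, Coord n m) p).map_target hy
  refine (key.comp (continuousOn_extChartAt_symm p) hmaps).congr fun y hy => ?_
  simp only [Function.comp, gram, Matrix.of_apply]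
  rw [← mfderiv_symm_eq p hy]

lemma gram_det_continuousOn (p : V) :
    ContinuousOn (fun y => (gram g p y).det) (extChartAt 𝓘(ℝ, Coord n m) p).target := by
  simp only [Matrix.det_apply]
  refine continuousOn_finsetSum _ fun s _ => ContinuousOn.const_smul ?_ _
  exact continuousOn_finsetProd _ fun i _ => gram_continuousOn g p _ _

lemma gram_det_pos (p : V) {y : Coord n m} (hy : y ∈ (extChartAt 𝓘(ℝ, Coord n m) p).target) :
    0 < (gram g p y).det := by
  have hinj : Function.Injective (coordFrame n m p y) := by
    have := isInvertible_mfderivWithin_extChartAt_symm (I := 𝓘(ℝ, Coord n m)) hy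
    simp only [modelWithCornersSelf_coe, range_id, mfderivWithin_univ] at this
    exact this.injective
  set D := coordFrame n m p y with hD
  apply Matrix.PosDef.det_pos
  refine Matrix.PosDef.of_dotProduct_mulVec_pos ?_ fun c hc => ?_
  · ext i j
    simp only [gram, Matrix.conjTranspose_apply, Matrix.of_apply, star_trivial]
    exact g.symm _ _ _
  · have hw : (WithLp.toLp 2 c : Coord n m) = ∑ i, c i • EuclideanSpace.single i (1 : ℝ) := by
      ext j
      simp only [WithLp.ofLp_sum, Finset.sum_apply, WithLp.ofLp_smul, Pi.smul_apply, PiLp.single_apply, smul_eq_mul, mul_ite, mul_one, mul_zero, Finset.sum_ite_eq, Finset.mem_univ, if_true]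
    have hne : D (WithLp.toLp 2 c : Coord n m) ≠ 0 := by
      intro h0
      apply hc
      have := hinj (h0.trans (map_zero D).symm)
      exact (WithLp.toLp_eq_zero 2).1 this
    have := g.pos _ _ hne
    rw [hw] at this
    refine this.trans_eq ?_
    have h1 : D (∑ i, c i • EuclideanSpace.single i (1 : ℝ) : Coord n m) =
        ∑ i, c i • D (EuclideanSpace.single i (1 : ℝ) : Coord n m) := by
      rw [map_sum]; simp only [map_smul]
    rw [h1]
    simp only [map_sum, map_smul, sum_apply, smul_apply,
      dotProduct, Matrix.mulVec, gram, Matrix.of_apply, star_trivial, smul_eq_mul, Finset.mul_sum]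
    rw [Finset.sum_comm]
    refine Finset.sum_congr rfl fun i _ => Finset.sum_congr rfl fun j _ => ?_
    rw [← hD]
    ring

section Vol

variable [T2Space V] [CompactSpace V]

variable (n m V) in
/-- A smooth partition of unity subordinate to the coordinate domains of `V`. -/
def chartPartition : SmoothPartitionOfUnity V 𝓘(ℝ, Coord n m) V univ :=
  (SmoothPartitionOfUnity.exists_isSubordinate_chartAt_source 𝓘(ℝ, Coord n m) V).choose

lemma chartPartition_subordinate :
    (chartPartition n m V).IsSubordinate fun p => (chartAt (Coord n m) p).source :=
  (SmoothPartitionOfUnity.exists_isSubordinate_chartAt_source 𝓘(ℝ, Coord n m) V).choose_spec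

lemma density_continuousOn (p : V) :
    ContinuousOn (fun y => chartPartition n m V p ((extChartAt 𝓘(ℝ, Coord n m) p).symm y) *
        √(gram g p y).det) (extChartAt 𝓘(ℝ, Coord n m) p).target :=
  ((chartPartition n m V p).contMDiff.continuous.comp_continuousOn
    (continuousOn_extChartAt_symm p)).mul (gram_det_continuousOn g p).sqrt

variable [MeasurableSpace V] [BorelSpace V]

/-- The Riemannian volume measure of `g`: the sum over the charts of the measures
`ρ_p √(det g_{αβ}) du`, where `(ρ_p)` is a partition of unity subordinate to the charts. By the
change of variables formula it does not depend on the partition. -/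
def vol : Measure V :=
  Measure.sum fun p : V =>
    ((volume.restrict (extChartAt 𝓘(ℝ, Coord n m) p).target).withDensity fun y =>
      ENNReal.ofReal (chartPartition n m V p ((extChartAt 𝓘(ℝ, Coord n m) p).symm y) *
        √(gram g p y).det)).map (extChartAt 𝓘(ℝ, Coord n m) p).symm

lemma symm_aemeasurable (p : V) : AEMeasurable (extChartAt 𝓘(ℝ, Coord n m) p).symm
    ((volume.restrict (extChartAt 𝓘(ℝ, Coord n m) p).target).withDensity fun y =>
      ENNReal.ofReal (chartPartition n m V p ((extChartAt 𝓘(ℝ, Coord n m) p).symm y) *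
        √(gram g p y).det)) :=
  ((continuousOn_extChartAt_symm p).aemeasurable
    (isOpen_extChartAt_target p).measurableSet).mono_ac (withDensity_absolutelyContinuous _ _)

instance : IsFiniteMeasure (vol g) := by
  constructor
  have hfin : {p : V | (Function.support (chartPartition n m V p)).Nonempty}.Finite :=
    (chartPartition n m V).locallyFinite.finite_nonempty_of_compact
  rw [vol, Measure.sum_apply _ MeasurableSet.univ, tsum_eq_sum (s := hfin.toFinset)]
  · refine ENNReal.sum_lt_top.2 fun p _ => ?_
    rw [Measure.map_apply_of_aemeasurable (symm_aemeasurable g p) MeasurableSet.univ, preimage_univ,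
      withDensity_apply _ MeasurableSet.univ, Measure.restrict_univ]
    set φ := extChartAt 𝓘(ℝ, Coord n m) p with hφ
    have hsub : tsupport (chartPartition n m V p) ⊆ φ.source := by
      rw [hφ, extChartAt_source]; exact chartPartition_subordinate p
    have hK : IsCompact (φ '' tsupport (chartPartition n m V p)) :=
      (isClosed_tsupport _).isCompact.image_of_continuousOn ((continuousOn_extChartAt p).mono hsub)
    have hKt : φ '' tsupport (chartPartition n m V p) ⊆ φ.target := by
      rintro _ ⟨x, hx, rfl⟩; exact φ.map_source (hsub hx)
    obtain ⟨C, hC⟩ := (hK.image_of_continuousOn ((density_continuousOn g p).mono hKt)).bddAbove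
    calc _ ≤ ∫⁻ y in φ.target, (φ '' tsupport (chartPartition n m V p)).indicator
            (fun _ => ENNReal.ofReal C) y := by
          refine setLIntegral_mono' (isOpen_extChartAt_target p).measurableSet fun y hy => ?_
          by_cases hyK : y ∈ φ '' tsupport (chartPartition n m V p)
          · rw [indicator_of_mem hyK]
            exact ENNReal.ofReal_le_ofReal (hC ⟨y, hyK, rfl⟩)
          · have : chartPartition n m V p (φ.symm y) = 0 := by
              by_contra hne
              exact hyK ⟨φ.symm y, subset_tsupport _ hne, φ.right_inv hy⟩
            simp [this]
      _ ≤ ∫⁻ y, (φ '' tsupport (chartPartition n m V p)).indicator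
            (fun _ => ENNReal.ofReal C) y := setLIntegral_le_lintegral _ _
      _ = ENNReal.ofReal C * volume (φ '' tsupport (chartPartition n m V p)) := by
          rw [lintegral_indicator hK.measurableSet, setLIntegral_const]
      _ < ⊤ := ENNReal.mul_lt_top ENNReal.ofReal_lt_top hK.measure_lt_top
  · intro p hp
    have h0 : ∀ x, chartPartition n m V p x = 0 := by
      intro x
      by_contra hx
      exact hp (hfin.mem_toFinset.2 ⟨x, hx⟩)
    simp [h0]

instance : (vol g).IsOpenPosMeasure := by
  constructor
  rintro U hU ⟨x, hxU⟩ h0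
  obtain ⟨p, hp⟩ := (chartPartition n m V).exists_pos_of_mem (mem_univ x)
  rw [vol, Measure.sum_apply _ hU.measurableSet, ENNReal.tsum_eq_zero] at h0
  have h1 := h0 p
  rw [Measure.map_apply_of_aemeasurable (symm_aemeasurable g p) hU.measurableSet,
    withDensity_apply_eq_zero' ((density_continuousOn g p).aemeasurable
      (isOpen_extChartAt_target p).measurableSet).ennreal_ofReal] at h1
  set φ := extChartAt 𝓘(ℝ, Coord n m) p with hφ
  have hxs : x ∈ φ.source := by
    rw [hφ, extChartAt_source]
    exact chartPartition_subordinate p (subset_tsupport _ hp.ne')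
  have hS : IsOpen (φ.target ∩ φ.symm ⁻¹' (U ∩ {z | 0 < chartPartition n m V p z})) :=
    (continuousOn_extChartAt_symm p).isOpen_inter_preimage (isOpen_extChartAt_target p)
      (hU.inter (isOpen_lt continuous_const (chartPartition n m V p).contMDiff.continuous))
  have hpos := hS.measure_pos volume ⟨φ x, φ.map_source hxs, by
    simp only [mem_preimage, φ.left_inv hxs]; exact ⟨hxU, hp⟩⟩
  refine hpos.ne' (measure_mono_null ?_
    ((Measure.restrict_apply_eq_zero' (isOpen_extChartAt_target p).measurableSet).1 h1))
  rintro y ⟨hyt, hyU, hyp⟩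
  refine ⟨⟨?_, hyU⟩, hyt⟩
  simp only [mem_ofPred_eq, ne_eq, ENNReal.ofReal_eq_zero, not_le]
  exact mul_pos hyp (Real.sqrt_pos.2 (gram_det_pos g p hyt))

end Vol
end Base

section Gerbe

variable {n m : ℕ} {V : Type*} [TopologicalSpace V] [ChartedSpace (Coord n m) V]
  [IsManifold 𝓘(ℝ, Coord n m) ∞ V]
  {Q : Type*} [NormedAddCommGroup Q] [NormedSpace ℝ Q]
  {I : Type*} {U : I → Opens V}
  {e : ∀ α, U α → Type*} [∀ α, TopologicalSpace (TotalSpace Q (e α))]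
  [∀ α x, NormedAddCommGroup (e α x)] [∀ α x, InnerProductSpace ℝ (e α x)]
  [∀ α, FiberBundle Q (e α)] [∀ α, VectorBundle ℝ Q (e α)]
  [∀ α, ContMDiffVectorBundle ∞ Q (e α) 𝓘(ℝ, Coord n m)]
  [∀ α, IsContMDiffRiemannianBundle 𝓘(ℝ, Coord n m) ∞ Q (e α)]

variable (n m Q U e) in
/-- The d-structure of the Riemannian vector bundles `e α` over the open sets `U α`, and a chain of
morphisms between their restrictions. Every fibre of `e α` is the orthogonal sum of its h-part and
its v-part; `ver` is the orthogonal projection onto the v-part. The morphisms `q α β`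
are smooth isomorphisms from `e β` to `e α` over `U α ∩ U β`, which preserve the scalar product and
the h-v-splitting. No cocycle condition is imposed on the chain. -/
structure DChain where
  /-- The vertical projection of the fibre at `x`. -/
  ver : ∀ α (x : U α), e α x →L[ℝ] e α x
  ver_idem : ∀ α x v, ver α x (ver α x v) = ver α x v
  /-- The h- and v-parts of the fibres are orthogonal. -/
  ver_symm : ∀ α x v w, inner ℝ (ver α x v) w = inner ℝ v (ver α x w)
  ver_smooth : ∀ α, ContMDiff (𝓘(ℝ, Coord n m).prod 𝓘(ℝ, Q)) (𝓘(ℝ, Coord n m).prod 𝓘(ℝ, Q)) ∞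
    (fun v : TotalSpace Q (e α) => (⟨v.proj, ver α v.proj v.2⟩ : TotalSpace Q (e α)))
  /-- The morphism `q α β` at the point `x` of `U α ∩ U β`. -/
  q : ∀ (α β : I) (x : V) (hα : x ∈ U α) (hβ : x ∈ U β), e β ⟨x, hβ⟩ ≃ₗᵢ[ℝ] e α ⟨x, hα⟩
  /-- `q α β` is smooth as a map defined on the part of the total space of `e β` over `U α`. -/
  q_smooth : ∀ α β, ContMDiff (𝓘(ℝ, Coord n m).prod 𝓘(ℝ, Q)) (𝓘(ℝ, Coord n m).prod 𝓘(ℝ, Q)) ∞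
    (fun v : (⟨{v : TotalSpace Q (e β) | (v.proj : V) ∈ U α},
        (U α).isOpen.preimage (continuous_subtype_val.comp (FiberBundle.continuous_proj Q (e β)))⟩ :
          Opens (TotalSpace Q (e β))) =>
      (⟨⟨(v.1.proj : V), v.2⟩, q α β v.1.proj v.2 v.1.proj.2 v.1.2⟩ : TotalSpace Q (e α)))
  q_ver : ∀ α β x hα hβ v,
    q α β x hα hβ (ver β ⟨x, hβ⟩ v) = ver α ⟨x, hα⟩ (q α β x hα hβ v)

variable (c : DChain n m Q U e)

/-- The vector space `Z(q)` of global sections: families of smooth sections `z α` of `e α` with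
`z α = q α β (z β)` on `U α ∩ U β`. -/
def GlobalSections : Submodule ℝ (∀ α, ContMDiffSection 𝓘(ℝ, Coord n m) Q ∞ (e α)) where
  carrier := {z | ∀ α β x (hα : x ∈ U α) (hβ : x ∈ U β),
    z α ⟨x, hα⟩ = c.q α β x hα hβ (z β ⟨x, hβ⟩)}
  add_mem' := by
    intro z w hz hw α β x hα hβ
    have := hz α β x hα hβ
    have := hw α β x hα hβ
    simp_all [ContMDiffSection.coe_add]
  zero_mem' := by
    intro α β x hα hβ
    simp [ContMDiffSection.coe_zero]
  smul_mem' := by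
    intro r z hz α β x hα hβ
    have := hz α β x hα hβ
    simp_all [ContMDiffSection.coe_smul]

variable (n m U) in
/-- A smooth partition of unity `(f α')` on `V` subordinate to the covering `U`: the support of
`f α'` is contained in `U (idx α')`. -/
structure SubordinatePartition (I' : Type*) where
  f : SmoothPartitionOfUnity I' 𝓘(ℝ, Coord n m) V univ
  idx : I' → I
  subordinate : f.IsSubordinate fun α' => (U (idx α') : Set V)

variable {N : NConnection n m V} (g : DMetric N) [T2Space V] [CompactSpace V]
  [MeasurableSpace V] [BorelSpace V] {I' : Type*} (P : SubordinatePartition n m U I')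

/-- The volume measure on an open subset. -/
def volOn (O : Opens V) : Measure O := (vol g).comap Subtype.val

/-- The scalar product `∑_{α'} ∫ ⟨f_{α'} s_{α(α')}, f_{α'} t_{α(α')}⟩`. -/
def pairing (s t : ∀ α (x : U α), e α x) : ℝ :=
  ∑ᶠ α' : I', ∫ x : U (P.idx α'),
    inner ℝ (P.f α' x • s (P.idx α') x) (P.f α' x • t (P.idx α') x) ∂(volOn g (U (P.idx α')))

/-- The space `Z(q)` with the scalar product `pairing g P`. -/
def PreHilbertZ (_g : DMetric N) (_P : SubordinatePartition n m U I') : Type _ := GlobalSections c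

instance : AddCommGroup (PreHilbertZ c g P) := inferInstanceAs (AddCommGroup (GlobalSections c))
instance : Module ℝ (PreHilbertZ c g P) := inferInstanceAs (Module ℝ (GlobalSections c))

variable {c g P}
/-- The underlying family of sections. -/
def PreHilbertZ.family (z : PreHilbertZ c g P) (α : I) (x : U α) : e α x := z.1 α x

lemma family_smooth (z : PreHilbertZ c g P) (α : I) : ContMDiff 𝓘(ℝ, Coord n m)
    (𝓘(ℝ, Coord n m).prod 𝓘(ℝ, Q)) ∞
    (fun x : U α => (⟨x, z.family α x⟩ : TotalSpace Q (e α))) := (z.1 α).contMDiff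

lemma family_add (z w : PreHilbertZ c g P) (α : I) (x : U α) :
    (z + w).family α x = z.family α x + w.family α x := rfl
lemma family_smul (r : ℝ) (z : PreHilbertZ c g P) (α : I) (x : U α) :
    (r • z).family α x = r • z.family α x := rfl

instance (O : Opens V) : IsFiniteMeasure (volOn g O) := by unfold volOn; infer_instance
instance (O : Opens V) : (volOn g O).IsOpenPosMeasure :=  by
  unfold volOn
  exact Measure.IsOpenPosMeasure.comap _ O.isOpenEmbedding'

lemma integrand_continuous (z w : PreHilbertZ c g P) (α' : I') :
    Continuous fun x : U (P.idx α') =>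
      inner ℝ (P.f α' x • z.family (P.idx α') x) (P.f α' x • w.family (P.idx α') x) := by
  have h := ((family_smooth z (P.idx α')).inner_bundle (family_smooth w (P.idx α'))).continuous
  have hf : Continuous fun x : U (P.idx α') => P.f α' x :=
    (P.f α').contMDiff.continuous.comp continuous_subtype_val
  simp only [real_inner_smul_left, real_inner_smul_right]
  exact hf.mul (hf.mul h)

lemma integrand_compact (z w : PreHilbertZ c g P) (α' : I') :
    HasCompactSupport fun x : U (P.idx α') =>
      inner ℝ (P.f α' x • z.family (P.idx α') x) (P.f α' x • w.family (P.idx α') x) := by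
  have hK : IsCompact ((Subtype.val : U (P.idx α') → V) ⁻¹' tsupport (P.f α')) := by
    refine Topology.IsInducing.subtypeVal.isCompact_preimage' (isClosed_tsupport _).isCompact ?_
    intro x hx
    exact ⟨⟨x, P.subordinate α' hx⟩, rfl⟩
  refine HasCompactSupport.intro hK fun x hx => ?_
  have : P.f α' x = 0 := by
    by_contra h
    exact hx (subset_tsupport _ h)
  simp [this]

lemma integrand_integrable (z w : PreHilbertZ c g P) (α' : I') :
    Integrable (fun x : U (P.idx α') =>
      inner ℝ (P.f α' x • z.family (P.idx α') x) (P.f α' x • w.family (P.idx α') x))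
      (volOn g (U (P.idx α'))) :=
  (integrand_continuous z w α').integrable_of_hasCompactSupport (integrand_compact z w α')

lemma partition_finite : {α' : I' | (Function.support (P.f α')).Nonempty}.Finite :=
  P.f.locallyFinite.finite_nonempty_of_compact

lemma pairing_support (s t : ∀ α (x : U α), e α x) : (Function.support fun α' : I' =>
    ∫ x : U (P.idx α'), inner ℝ (P.f α' x • s (P.idx α') x) (P.f α' x • t (P.idx α') x)
      ∂(volOn g (U (P.idx α')))).Finite := by
  refine (partition_finite (P := P)).subset fun α' h => ?_
  by_contra hn
  have : ∀ x, P.f α' x = 0 := fun x => by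
    by_contra hx
    exact hn ⟨x, hx⟩
  exact h (by simp [this])

instance core : InnerProductSpace.Core ℝ (PreHilbertZ c g P) where
  inner z w := pairing g P z.family w.family
  conj_inner_symm z w := by
    simp only [pairing, conj_trivial]
    exact finsum_congr fun α' => integral_congr_ae (ae_of_all _ fun x => real_inner_comm _ _)
  re_inner_nonneg z := by
    simp only [pairing, RCLike.re_to_real]
    exact finsum_nonneg fun α' => integral_nonneg fun x => real_inner_self_nonneg
  add_left z w u := by
    simp only [pairing]
    rw [← finsum_add_distrib (pairing_support _ _) (pairing_support _ _)]
    refine finsum_congr fun α' => ?_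
    rw [← integral_add (integrand_integrable _ _ _) (integrand_integrable _ _ _)]
    refine integral_congr_ae (ae_of_all _ fun x => ?_)
    simp only [family_add, smul_add, inner_add_left]
  smul_left z w r := by
    simp only [pairing, conj_trivial]
    rw [mul_finsum]
    refine finsum_congr fun α' => ?_
    rw [← integral_const_mul]
    refine integral_congr_ae (ae_of_all _ fun x => ?_)
    simp only [family_smul, smul_comm _ r, real_inner_smul_left]
  definite z h := by
    have h1 : ∀ α' : I', ∀ x : U (P.idx α'), P.f α' x • z.family (P.idx α') x = 0 := by
      intro α'
      have hnn : ∀ β' : I', 0 ≤ ∫ x : U (P.idx β'),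
          inner ℝ (P.f β' x • z.family (P.idx β') x) (P.f β' x • z.family (P.idx β') x)
          ∂(volOn g (U (P.idx β'))) := fun β' => integral_nonneg fun x => real_inner_self_nonneg
      have hle := single_le_finsum α' (pairing_support (g := g) (P := P) z.family z.family) hnn
      have h0 := le_antisymm (hle.trans_eq h) (hnn α')
      rw [integral_eq_zero_iff_of_nonneg (fun x => real_inner_self_nonneg)
        (integrand_integrable _ _ _)] at h0
      have := (integrand_continuous z z α').ae_eq_iff_eq (volOn g (U (P.idx α')))
        continuous_zero |>.1 h0
      intro x
      exact inner_self_eq_zero.1 (congrFun this x)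
    apply Subtype.ext
    funext α
    ext x
    obtain ⟨α', hα'⟩ := P.f.exists_pos_of_mem (mem_univ (x : V))
    have hx : (x : V) ∈ U (P.idx α') := P.subordinate α' (subset_tsupport _ hα'.ne')
    have h2 := h1 α' ⟨x, hx⟩
    rw [smul_eq_zero, or_iff_right hα'.ne'] at h2
    have h3 : z.1 α x = _ := z.2 α (P.idx α') x x.2 hx
    have h4 : z.1 (P.idx α') ⟨x, hx⟩ = 0 := h2
    rw [h3, h4, map_zero]
    rfl

instance : NormedAddCommGroup (PreHilbertZ c g P) :=
  InnerProductSpace.Core.toNormedAddCommGroup (𝕜 := ℝ)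

instance : InnerProductSpace ℝ (PreHilbertZ c g P) := InnerProductSpace.ofCore _

lemma inner_eq (z w : PreHilbertZ c g P) : inner ℝ z w = pairing g P z.family w.family := rfl

variable (c g P) in
/-- The Hilbert completion `L²(Z(q))` of `Z(q)`. -/
abbrev L2Z : Type _ := UniformSpace.Completion (PreHilbertZ c g P)

/-- An `L²` section of `e α`: a section that is measurable in the local trivializations and has
square integrable norm, with respect to the volume measure of `g` on `U α`. -/
structure IsL2Section (g : DMetric N) (α : I) (s : ∀ x : U α, e α x) : Prop where
  aestronglyMeasurable : ∀ x₀ : U α,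
    AEStronglyMeasurable (fun x => (trivializationAt Q (e α) x₀ ⟨x, s x⟩).2)
      ((volOn g (U α)).restrict (trivializationAt Q (e α) x₀).baseSet)
  lintegral_lt_top : ∫⁻ x, ‖s x‖ₑ ^ 2 ∂(volOn g (U α)) < ⊤

/-- A compatible family of `L²` sections: `s α` is an `L²` section of `e α` and
`s α = q α β (s β)` almost everywhere on `U α ∩ U β`. -/
structure IsL2Family (c : DChain n m Q U e) (g : DMetric N) (s : ∀ α (x : U α), e α x) :
    Prop where
  isL2Section : ∀ α, IsL2Section (Q := Q) g α (s α)
  compat : ∀ α β, ∀ᵐ x ∂(vol g), ∀ (hα : x ∈ U α) (hβ : x ∈ U β),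
    s α ⟨x, hα⟩ = c.q α β x hα hβ (s β ⟨x, hβ⟩)

/-- Two families of sections agree almost everywhere. -/
def AEEq (g : DMetric N) (s t : ∀ α (x : U α), e α x) : Prop :=
  ∀ α, ∀ᵐ x ∂(volOn g (U α)), s α x = t α x

/-- The v-part of a family of sections. -/
def verPart (c : DChain n m Q U e) (s : ∀ α (x : U α), e α x) (α : I) (x : U α) : e α x :=
  c.ver α x (s α x)

/-- The h-part of a family of sections. -/
def horPart (c : DChain n m Q U e) (s : ∀ α (x : U α), e α x) (α : I) (x : U α) : e α x :=
  s α x - c.ver α x (s α x)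

/-- `T` identifies the elements of `L²(Z(q))` with compatible families of `L²` sections (modulo
equality almost everywhere): it extends the inclusion of `Z(q)`, it is linear, and the scalar
product of `L²(Z(q))` is given by the same formula as that of `Z(q)`. -/
structure IsRealization (c : DChain n m Q U e) (g : DMetric N) (P : SubordinatePartition n m U I')
    (T : L2Z c g P → ∀ α (x : U α), e α x) : Prop where
  isL2Family : ∀ ζ, IsL2Family c g (T ζ)
  coe : ∀ z : PreHilbertZ c g P, AEEq g (T (z : L2Z c g P)) z.family
  add : ∀ ζ η, AEEq g (T (ζ + η)) (T ζ + T η)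
  smul : ∀ (r : ℝ) ζ, AEEq g (T (r • ζ)) (r • T ζ)
  inner : ∀ ζ η : L2Z c g P, inner ℝ ζ η = pairing g P (T ζ) (T η)

/-- The realization `T` is N-adapted: every element of `L²(Z(q))` is the sum of an h-part and a
v-part in `L²(Z(q))`, orthogonal to each other, which are realized by the h- and v-parts of the
family of sections, and the scalar product is the sum of its h- and v-components. -/
structure IsNAdapted (c : DChain n m Q U e) (g : DMetric N) (P : SubordinatePartition n m U I')
    (T : L2Z c g P → ∀ α (x : U α), e α x) : Prop where
  splitting : ∃ h v : L2Z c g P →L[ℝ] L2Z c g P,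
    (∀ ζ, h ζ + v ζ = ζ) ∧ (∀ ζ η, inner ℝ (h ζ) (v η) = 0) ∧
    (∀ ζ, AEEq g (T (h ζ)) (horPart c (T ζ))) ∧ (∀ ζ, AEEq g (T (v ζ)) (verPart c (T ζ)))
  inner_split : ∀ ζ η : L2Z c g P, inner ℝ ζ η =
    pairing g P (horPart c (T ζ)) (horPart c (T η)) +
      pairing g P (verPart c (T ζ)) (verPart c (T η))

end Gerbe
end NGerbe

end

/-! The compatible families of `L²` sections carry the same pairing as `Z(q)`. The point is that,
modulo equality almost everywhere, they form a Hilbert space. Since `Z(q)` sits in it isometrically,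
the completion of `Z(q)` then embeds isometrically by extension from a dense subspace, and `T` picks
representatives of the image.

Completeness rests on one estimate, `lintegral_le_sum`. If `k` functions `f i` of the partition are
not identically zero, Cauchy–Schwarz gives `1 = (∑ f i)² ≤ k ∑ (f i)²`. As the `q α β` are fibrewise
isometries, `|s α| = |s (idx i)|` almost everywhere on the overlap, so `∫ |s α|² ≤ k ⟨s, s⟩` for
every `α`. Conversely `f i ≤ 1` bounds `⟨s, s⟩` by finitely many masses. Hence the null space of the
pairing is equality to zero almost everywhere, and the Riesz–Fischer argument works in the varying
fibres: a fast Cauchy sequence converges at almost every point, Fatou's lemma bounds the distance to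
the limit, and compatibility passes to the limit.

The vertical projection is a symmetric idempotent in each fibre and commutes with `q`. So it is an
orthogonal projection, of norm at most 1, both on `Z(q)` and on the `L²` families. Its extension to
the completion is intertwined by `T`, because this holds on `Z(q)` and is a closed condition.
Uniqueness is again density: any realization preserves scalar products, hence is continuous modulo
null sets. -/

set_option linter.unusedSectionVars false

noncomputable section

namespace NGerbe

/-! ### Measurable sections of a Riemannian vector bundle -/

section MeasurableSections

variable {B : Type*} [TopologicalSpace B] [MeasurableSpace B] [BorelSpace B]
  {F : Type*} [NormedAddCommGroup F] [NormedSpace ℝ F] [FiniteDimensional ℝ F]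
  {E : B → Type*} [TopologicalSpace (TotalSpace F E)]
  [∀ x, NormedAddCommGroup (E x)] [∀ x, InnerProductSpace ℝ (E x)]
  [FiberBundle F E] [VectorBundle ℝ F E]

variable (F) in
/-- A section that is measurable in the local trivializations. -/
def AEMeasurableSection (μ : Measure B) (s : ∀ x, E x) : Prop :=
  ∀ x₀ : B, AEStronglyMeasurable (fun x => (trivializationAt F E x₀ ⟨x, s x⟩).2)
    (μ.restrict (trivializationAt F E x₀).baseSet)

variable {μ : Measure B}

/-- In a trivialization `H` becomes a continuous function on `baseSet × F`, which is composed with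
the measurable map from `x` to `x` and the coordinates of `s x`. The trivialization need not be
isometric, so this is how norms become measurable. -/
lemma AEMeasurableSection.aestronglyMeasurable_comp {s : ∀ x, E x}
    (hs : AEMeasurableSection F μ s) {G : Type*} [NormedAddCommGroup G] [SecondCountableTopology G]
    {H : TotalSpace F E → G} (x₀ : B)
    (hH : ContinuousOn H (TotalSpace.proj ⁻¹' (trivializationAt F E x₀).baseSet)) :
    AEStronglyMeasurable (fun x => H ⟨x, s x⟩) (μ.restrict (trivializationAt F E x₀).baseSet) := by
  borelize F
  borelize G
  have : ProperSpace F := FiniteDimensional.proper ℝ F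
  set t := trivializationAt F E x₀ with ht
  have hm : MeasurableSet t.baseSet := t.open_baseSet.measurableSet
  have hK : ContinuousOn (fun p : B × F => H (t.toOpenPartialHomeomorph.symm p))
      (t.baseSet ×ˢ univ) := by
    rw [← t.target_eq]
    refine hH.comp t.toOpenPartialHomeomorph.continuousOn_symm fun p hp => ?_
    have := t.toOpenPartialHomeomorph.map_target hp
    rwa [← t.source_eq]
  have hw : AEMeasurable (fun x => (x, (t ⟨x, s x⟩).2)) (μ.restrict t.baseSet) :=
    aemeasurable_id.prodMk (hs x₀).aemeasurable
  -- Extension by zero makes the function Borel on all of `B × F`.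
  have hmeas : Measurable ((t.baseSet ×ˢ (univ : Set F)).indicator
      fun p : B × F => H (t.toOpenPartialHomeomorph.symm p)) := by
    classical
    rw [← piecewise_eq_indicator]
    exact hK.measurable_piecewise continuousOn_const (hm.prod MeasurableSet.univ)
  refine ((hmeas.comp_aemeasurable hw).congr ?_).aestronglyMeasurable
  filter_upwards [ae_restrict_mem hm] with x hx
  have hx' : (x, (t ⟨x, s x⟩).2) ∈ t.baseSet ×ˢ (univ : Set F) := ⟨hx, mem_univ _⟩
  have h1 : ((x, (t ⟨x, s x⟩).2) : B × F) = t ⟨x, s x⟩ := by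
    exact t.mk_proj_snd' (x := ⟨x, s x⟩) hx
  simp only [Function.comp, indicator_of_mem hx']
  rw [h1]
  congr 1
  exact t.toOpenPartialHomeomorph.left_inv (x := ⟨x, s x⟩) (t.mem_source.2 hx)

/-- By the Lindelöf property countably many trivializing sets cover the base. -/
lemma aestronglyMeasurable_of_baseSet [SecondCountableTopology B] {G : Type*}
    [NormedAddCommGroup G] {f : B → G}
    (hf : ∀ x₀ : B, AEStronglyMeasurable f (μ.restrict (trivializationAt F E x₀).baseSet)) :
    AEStronglyMeasurable f μ := by
  obtain ⟨T, hT, hU⟩ := TopologicalSpace.isOpen_iUnion_countable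
    (fun x₀ : B => (trivializationAt F E x₀).baseSet) fun x₀ =>
      (trivializationAt F E x₀).open_baseSet
  have huniv : ⋃ i : T, (trivializationAt F E (i : B)).baseSet = univ := by
    rw [← biUnion_eq_iUnion T fun x _ => (trivializationAt F E x).baseSet, hU, eq_univ_iff_forall]
    exact fun x => mem_iUnion.2 ⟨x, mem_baseSet_trivializationAt F E x⟩
  have := hT.to_subtype
  rw [← Measure.restrict_univ (μ := μ), ← huniv, aestronglyMeasurable_iUnion_iff]
  exact fun i => hf i

lemma continuous_norm_totalSpace [IsContinuousRiemannianBundle F E] :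
    Continuous fun v : TotalSpace F E => ‖v.2‖ := by
  have h : Continuous fun v : TotalSpace F E => (inner ℝ v.2 v.2 : ℝ) :=
    Continuous.inner_bundle (F := F) (b := TotalSpace.proj) (v := fun v => v.2) (w := fun v => v.2)
      continuous_id continuous_id
  simpa [real_inner_self_eq_norm_sq] using h.sqrt

namespace AEMeasurableSection

lemma norm [SecondCountableTopology B] [IsContinuousRiemannianBundle F E] {s : ∀ x, E x}
    (hs : AEMeasurableSection F μ s) : AEStronglyMeasurable (fun x => ‖s x‖) μ :=
  aestronglyMeasurable_of_baseSet (F := F) (E := E) fun x₀ =>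
    hs.aestronglyMeasurable_comp x₀ continuous_norm_totalSpace.continuousOn

lemma map {s : ∀ x, E x} (hs : AEMeasurableSection F μ s) {L : ∀ x, E x → E x}
    (hL : Continuous fun v : TotalSpace F E => (⟨v.proj, L v.proj v.2⟩ : TotalSpace F E)) :
    AEMeasurableSection F μ fun x => L x (s x) := by
  intro x₀
  have : ProperSpace F := FiniteDimensional.proper ℝ F
  refine hs.aestronglyMeasurable_comp (H := fun v =>
    (trivializationAt F E x₀ ⟨v.proj, L v.proj v.2⟩).2) x₀ ?_
  refine continuous_snd.comp_continuousOn
    ((trivializationAt F E x₀).continuousOn.comp hL.continuousOn fun v hv => ?_)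
  exact (trivializationAt F E x₀).mem_source.2 hv

lemma of_continuous {s : ∀ x, E x}
    (hs : Continuous fun x => (⟨x, s x⟩ : TotalSpace F E)) : AEMeasurableSection F μ s := by
  intro x₀
  have : ProperSpace F := FiniteDimensional.proper ℝ F
  refine ContinuousOn.aestronglyMeasurable ?_ (trivializationAt F E x₀).open_baseSet.measurableSet
  refine continuous_snd.comp_continuousOn
    ((trivializationAt F E x₀).continuousOn.comp hs.continuousOn fun x hx => ?_)
  exact (trivializationAt F E x₀).mem_source.2 hx

lemma add {s t : ∀ x, E x} (hs : AEMeasurableSection F μ s) (ht : AEMeasurableSection F μ t) :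
    AEMeasurableSection F μ fun x => s x + t x := by
  intro x₀
  refine ((hs x₀).add (ht x₀)).congr ?_
  filter_upwards [ae_restrict_mem (trivializationAt F E x₀).open_baseSet.measurableSet] with x hx
  exact (((trivializationAt F E x₀).linear ℝ hx).map_add _ _).symm

lemma smul {s : ∀ x, E x} (hs : AEMeasurableSection F μ s) (r : ℝ) :
    AEMeasurableSection F μ fun x => r • s x := by
  intro x₀
  refine ((hs x₀).const_smul r).congr ?_
  filter_upwards [ae_restrict_mem (trivializationAt F E x₀).open_baseSet.measurableSet] with x hx
  exact (((trivializationAt F E x₀).linear ℝ hx).map_smul _ _).symm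

lemma sub {s t : ∀ x, E x} (hs : AEMeasurableSection F μ s) (ht : AEMeasurableSection F μ t) :
    AEMeasurableSection F μ fun x => s x - t x := by
  simpa [sub_eq_add_neg] using hs.add (ht.smul (-1))

lemma inner [SecondCountableTopology B] [IsContinuousRiemannianBundle F E] {s t : ∀ x, E x}
    (hs : AEMeasurableSection F μ s) (ht : AEMeasurableSection F μ t) :
    AEStronglyMeasurable (fun x => (inner ℝ (s x) (t x) : ℝ)) μ := by
  -- Polarization reduces the scalar product to norms.
  refine ((((hs.add ht).norm.mul (hs.add ht).norm).sub (hs.norm.mul hs.norm)).sub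
    (ht.norm.mul ht.norm)).mul_const 2⁻¹ |>.congr (ae_of_all _ fun x => ?_)
  simp only [Pi.mul_apply, Pi.sub_apply]
  rw [real_inner_eq_norm_add_mul_self_sub_norm_mul_self_sub_norm_mul_self_div_two, div_eq_mul_inv]

lemma of_tendsto {s : ∀ x, E x} {u : ℕ → ∀ x, E x} (hu : ∀ k, AEMeasurableSection F μ (u k))
    (h : ∀ᵐ x ∂μ, Tendsto (fun k => u k x) atTop (𝓝 (s x))) : AEMeasurableSection F μ s := by
  intro x₀
  refine aestronglyMeasurable_of_tendsto_ae atTop (fun k => hu k x₀) ?_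
  filter_upwards [ae_restrict_mem (trivializationAt F E x₀).open_baseSet.measurableSet,
    ae_restrict_of_ae h] with x hx hlim
  -- Convergence in the fibre is convergence of the coordinates.
  have := (((trivializationAt F E x₀).continuousLinearEquivAt ℝ x hx).continuous.tendsto (s x)).comp
    hlim
  simpa [Function.comp_def] using this

end AEMeasurableSection

lemma completeSpace_fiber {x x₀ : B} (hx : x ∈ (trivializationAt F E x₀).baseSet) :
    CompleteSpace (E x) := by
  have e := (trivializationAt F E x₀).continuousLinearEquivAt ℝ x hx
  have : FiniteDimensional ℝ (E x) := e.symm.toLinearEquiv.finiteDimensional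
  exact FiniteDimensional.complete ℝ (E x)

end MeasurableSections

lemma secondCountableTopology_opens (n m : ℕ) {V : Type*} [TopologicalSpace V]
    [ChartedSpace (Coord n m) V] [CompactSpace V] (O : Opens V) : SecondCountableTopology O := by
  have : SecondCountableTopology V :=
    ChartedSpace.secondCountable_of_sigmaCompact (Coord n m) V
  infer_instance

lemma isContinuousRiemannianBundle (n m : ℕ) {B : Type*} [TopologicalSpace B]
    [ChartedSpace (Coord n m) B] (F : Type*) [NormedAddCommGroup F] [NormedSpace ℝ F]
    (E : B → Type*) [TopologicalSpace (TotalSpace F E)]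
    [∀ x, NormedAddCommGroup (E x)] [∀ x, InnerProductSpace ℝ (E x)]
    [FiberBundle F E] [VectorBundle ℝ F E]
    [IsContMDiffRiemannianBundle 𝓘(ℝ, Coord n m) ∞ F E] : IsContinuousRiemannianBundle F E := by
  obtain ⟨b, hb, h⟩ := IsContMDiffRiemannianBundle.exists_contMDiff (IB := 𝓘(ℝ, Coord n m))
    (n := ∞) (F := F) (E := E)
  exact ⟨b, hb.continuous, h⟩

/-! ### Square integrable sections over the sets of the covering -/

section Families

variable {n m : ℕ} {V : Type*} [TopologicalSpace V] [ChartedSpace (Coord n m) V]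
  [IsManifold 𝓘(ℝ, Coord n m) ∞ V] [T2Space V] [CompactSpace V]
  [MeasurableSpace V] [BorelSpace V] {N : NConnection n m V} {g : DMetric N}
  {Q : Type*} [NormedAddCommGroup Q] [NormedSpace ℝ Q] [FiniteDimensional ℝ Q]
  {I : Type*} {U : I → Opens V}
  {e : ∀ α, U α → Type*} [∀ α, TopologicalSpace (TotalSpace Q (e α))]
  [∀ α x, NormedAddCommGroup (e α x)] [∀ α x, InnerProductSpace ℝ (e α x)]
  [∀ α, FiberBundle Q (e α)] [∀ α, VectorBundle ℝ Q (e α)]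
  [∀ α, ContMDiffVectorBundle ∞ Q (e α) 𝓘(ℝ, Coord n m)]
  [∀ α, IsContMDiffRiemannianBundle 𝓘(ℝ, Coord n m) ∞ Q (e α)]
  {c : DChain n m Q U e} {I' : Type*} {P : SubordinatePartition n m U I'}

lemma measurableEmbedding_val (O : Opens V) : MeasurableEmbedding (Subtype.val : O → V) :=
  MeasurableEmbedding.subtype_coe O.isOpen.measurableSet

/-- Limits of sections exist almost everywhere on `U α`, whereas compatibility is a statement almost
everywhere on `V`; this passes between the two. The push-forward of `volOn g O` to `V` is the
restriction of `vol g`. -/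
lemma ae_volOn_iff {O : Opens V} {p : O → Prop} :
    (∀ᵐ x ∂(volOn g O), p x) ↔ ∀ᵐ x ∂(vol g), ∀ h : x ∈ O, p ⟨x, h⟩ := by
  classical
  have h1 : (fun x : V => ∀ h : x ∈ O, p ⟨x, h⟩) = fun x : V => x ∈ (O : Set V) →
      ∀ h : x ∈ O, p ⟨x, h⟩ := by
    funext x
    exact propext ⟨fun h _ => h, fun h hx => h hx hx⟩
  rw [h1, ← ae_restrict_iff' O.isOpen.measurableSet]
  have h2 := (measurableEmbedding_val O).map_comap (vol g)
  rw [Subtype.range_coe] at h2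
  change _ ↔ ∀ᵐ x ∂((vol g).restrict (O : Set V)), _
  rw [← h2, (measurableEmbedding_val O).ae_map_iff]
  exact ⟨fun h => h.mono fun x hx _ => hx, fun h => h.mono fun x hx => hx x.2⟩

namespace IsL2Section

variable {α : I} {s t : ∀ x : U α, e α x}

lemma aemeasurableSection (hs : IsL2Section (Q := Q) g α s) :
    AEMeasurableSection Q (volOn g (U α)) s := hs.aestronglyMeasurable

lemma memLp_norm (hs : IsL2Section (Q := Q) g α s) :
    MemLp (fun x => ‖s x‖) 2 (volOn g (U α)) := by
  have := secondCountableTopology_opens n m (U α)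
  have := isContinuousRiemannianBundle n m Q (e α)
  have hm := hs.aemeasurableSection.norm
  rw [memLp_two_iff_integrable_sq_norm hm]
  refine ⟨(hm.norm.pow 2), ?_⟩
  simpa [HasFiniteIntegral, enorm_pow] using hs.lintegral_lt_top

lemma of_memLp_norm (hs : AEMeasurableSection Q (volOn g (U α)) s)
    (h : MemLp (fun x => ‖s x‖) 2 (volOn g (U α))) : IsL2Section (Q := Q) g α s := by
  refine ⟨hs, ?_⟩
  have := ((memLp_two_iff_integrable_sq_norm h.1).1 h).2
  simpa [HasFiniteIntegral, enorm_pow] using this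

lemma add (hs : IsL2Section (Q := Q) g α s) (ht : IsL2Section (Q := Q) g α t) :
    IsL2Section (Q := Q) g α fun x => s x + t x := by
  have := secondCountableTopology_opens n m (U α)
  have := isContinuousRiemannianBundle n m Q (e α)
  have hm := hs.aemeasurableSection.add ht.aemeasurableSection
  refine of_memLp_norm hm ((hs.memLp_norm.add ht.memLp_norm).mono hm.norm (ae_of_all _ fun x => ?_))
  simp only [Pi.add_apply, norm_norm]
  exact (norm_add_le _ _).trans (le_abs_self _)

lemma smul (hs : IsL2Section (Q := Q) g α s) (r : ℝ) :
    IsL2Section (Q := Q) g α fun x => r • s x := by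
  have := secondCountableTopology_opens n m (U α)
  have := isContinuousRiemannianBundle n m Q (e α)
  have hm := hs.aemeasurableSection.smul r
  refine of_memLp_norm hm ((hs.memLp_norm.const_mul r).mono hm.norm (ae_of_all _ fun x => ?_))
  simp [norm_smul]

lemma ver (hs : IsL2Section (Q := Q) g α s) (c : DChain n m Q U e) :
    IsL2Section (Q := Q) g α fun x => c.ver α x (s x) := by
  have := secondCountableTopology_opens n m (U α)
  have := isContinuousRiemannianBundle n m Q (e α)
  have hm := hs.aemeasurableSection.map (L := fun x => c.ver α x) (c.ver_smooth α).continuous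
  refine of_memLp_norm hm (hs.memLp_norm.mono hm.norm (ae_of_all _ fun x => ?_))
  simp only [norm_norm]
  -- For a symmetric idempotent `p`, `|pv|² = ⟨pv, v⟩ ≤ |pv| |v|`; cancelling `|pv|` needs the case
  -- `|pv| = 0` apart.
  have h1 : ‖c.ver α x (s x)‖ * ‖c.ver α x (s x)‖ ≤ ‖c.ver α x (s x)‖ * ‖s x‖ := by
    rw [← real_inner_self_eq_norm_mul_norm, c.ver_symm, c.ver_idem, real_inner_comm]
    exact real_inner_le_norm _ _
  rcases (norm_nonneg (c.ver α x (s x))).eq_or_lt with h | h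
  · rw [← h]; exact norm_nonneg _
  · exact le_of_mul_le_mul_left h1 h

lemma integrable_inner (hs : IsL2Section (Q := Q) g α s) (ht : IsL2Section (Q := Q) g α t)
    {f : V → ℝ} (hf : Continuous f) {C : ℝ} (hC : ∀ x, ‖f x‖ ≤ C) :
    Integrable (fun x : U α => (inner ℝ (f x • s x) (f x • t x) : ℝ)) (volOn g (U α)) := by
  have := secondCountableTopology_opens n m (U α)
  have := isContinuousRiemannianBundle n m Q (e α)
  have h1 : Integrable (fun x : U α => (inner ℝ (s x) (t x) : ℝ)) (volOn g (U α)) := by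
    refine (hs.memLp_norm.integrable_mul ht.memLp_norm).mono
      (hs.aemeasurableSection.inner ht.aemeasurableSection) (ae_of_all _ fun x => ?_)
    simpa using norm_inner_le_norm (𝕜 := ℝ) (s x) (t x)
  have hf' : AEStronglyMeasurable (fun x : U α => f x) (volOn g (U α)) :=
    (hf.comp continuous_subtype_val).aestronglyMeasurable
  have h2 := (h1.bdd_mul hf' (ae_of_all _ fun x => hC x)).bdd_mul hf' (ae_of_all _ fun x => hC x)
  refine h2.congr (ae_of_all _ fun x => ?_)
  simp only [real_inner_smul_left, real_inner_smul_right]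

end IsL2Section

/-! ### Comparison of the pairing with the `L²` masses -/

lemma partition_norm_le_one (P : SubordinatePartition n m U I') (i : I') (x : V) : ‖P.f i x‖ ≤ 1 := by
  rw [Real.norm_of_nonneg (P.f.nonneg i x)]
  exact P.f.le_one i x

variable (P) in
/-- The finitely many indices of the functions of the partition that do not vanish identically. -/
def activeIndices : Finset I' := (partition_finite (P := P)).toFinset

lemma eq_zero_of_notMem_activeIndices {i : I'} (hi : i ∉ activeIndices P) (x : V) :
    P.f i x = 0 := by
  by_contra h
  exact hi ((partition_finite (P := P)).mem_toFinset.2 ⟨x, h⟩)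

lemma pairing_eq_sum (s t : ∀ α (x : U α), e α x) :
    pairing g P s t = ∑ i ∈ activeIndices P, ∫ x : U (P.idx i),
      inner ℝ (P.f i x • s (P.idx i) x) (P.f i x • t (P.idx i) x) ∂(volOn g (U (P.idx i))) := by
  refine finsum_eq_sum_of_support_subset _ fun i hi => ?_
  by_contra h
  exact hi (by simp [eq_zero_of_notMem_activeIndices h])

/-- Cauchy–Schwarz applied to `∑ f i = 1`; the source of the constant in all later estimates. -/
lemma one_le_card_mul_sum_sq (x : V) :
    1 ≤ (activeIndices P).card * ∑ i ∈ activeIndices P, P.f i x ^ 2 := by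
  have h : ∑ i ∈ activeIndices P, P.f i x = 1 := by
    rw [← P.f.sum_eq_one (mem_univ x)]
    refine (finsum_eq_sum_of_support_subset _ fun i hi => ?_).symm
    by_contra h
    exact hi (eq_zero_of_notMem_activeIndices h x)
  have := sq_sum_le_card_mul_sum_sq (s := activeIndices P) (f := fun i => P.f i x)
  rwa [h, one_pow] at this

lemma IsL2Family.integrable {s t : ∀ α (x : U α), e α x} (hs : IsL2Family c g s)
    (ht : IsL2Family c g t) (i : I') :
    Integrable (fun x : U (P.idx i) =>
      (inner ℝ (P.f i x • s (P.idx i) x) (P.f i x • t (P.idx i) x) : ℝ))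
      (volOn g (U (P.idx i))) :=
  (hs.isL2Section _).integrable_inner (ht.isL2Section _) (P.f i).contMDiff.continuous
    (partition_norm_le_one P i)

/-- Only integrability of the cut-off integrands is assumed, so that it applies to smooth sections
before they are known to be square integrable. -/
lemma ofReal_pairing {s : ∀ α (x : U α), e α x} (hs : ∀ i, Integrable (fun x : U (P.idx i) =>
      (inner ℝ (P.f i x • s (P.idx i) x) (P.f i x • s (P.idx i) x) : ℝ))
      (volOn g (U (P.idx i)))) :
    ENNReal.ofReal (pairing g P s s) = ∑ i ∈ activeIndices P, ∫⁻ x : U (P.idx i),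
      ‖P.f i x‖ₑ ^ 2 * ‖s (P.idx i) x‖ₑ ^ 2 ∂(volOn g (U (P.idx i))) := by
  rw [pairing_eq_sum, ENNReal.ofReal_sum_of_nonneg fun i _ =>
    integral_nonneg fun x => real_inner_self_nonneg]
  refine Finset.sum_congr rfl fun i _ => ?_
  rw [ofReal_integral_eq_lintegral_ofReal (hs i)
    (ae_of_all _ fun x => real_inner_self_nonneg)]
  refine lintegral_congr fun x => ?_
  rw [real_inner_self_eq_norm_sq, ENNReal.ofReal_pow (norm_nonneg _), ofReal_norm,
    enorm_smul, mul_pow]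

/-- By compatibility, the mass of `f s α` is at most that of `f s β` if `f` is supported in
`U β`. -/
lemma lintegral_le_of_compat {s : ∀ α (x : U α), e α x} (α β : I)
    (hs : ∀ᵐ x ∂(vol g), ∀ (hα : x ∈ U α) (hβ : x ∈ U β),
      s α ⟨x, hα⟩ = c.q α β x hα hβ (s β ⟨x, hβ⟩)) {f : V → ℝ≥0∞} (hf : ∀ x ∉ U β, f x = 0) :
    ∫⁻ x : U α, f x * ‖s α x‖ₑ ^ 2 ∂(volOn g (U α)) ≤
      ∫⁻ x : U β, f x * ‖s β x‖ₑ ^ 2 ∂(volOn g (U β)) := by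
  classical
  -- Both integrands are extended by zero to `V` and compared pointwise: they agree on the overlap
  -- because `q` is isometric, and `f` vanishes off `U β`.
  let G : I → V → ℝ≥0∞ := fun γ x => if h : x ∈ U γ then f x * ‖s γ ⟨x, h⟩‖ₑ ^ 2 else 0
  have key : ∀ γ, ∫⁻ x : U γ, f x * ‖s γ x‖ₑ ^ 2 ∂(volOn g (U γ)) = ∫⁻ x, G γ x ∂(vol g) := by
    intro γ
    have h1 : ∀ x : U γ, f x * ‖s γ x‖ₑ ^ 2 = G γ x := fun x => by simp [G]
    simp only [h1]
    have h2 : (U γ : Set V).indicator (G γ) = G γ :=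
      indicator_eq_self.2 fun x hx => by
        by_contra h
        exact hx (dif_neg h)
    have h3 := lintegral_subtype_comap (μ := vol g) (U γ).isOpen.measurableSet (G γ)
    rw [← lintegral_indicator (U γ).isOpen.measurableSet, h2] at h3
    exact h3
  rw [key, key]
  refine lintegral_mono_ae ?_
  filter_upwards [hs] with x hx
  by_cases hα : x ∈ U α
  · by_cases hβ : x ∈ U β
    · simp [G, hα, hβ, hx hα hβ]
    · simp [G, hα, hf x hβ]
  · simp [G, hα]

variable (P) in
-- The key estimate: the mass over `U α` is spread over the partition, and compatibility moves each
-- piece to `U (P.idx i)`. It controls every `α`, including those outside the range of `P.idx`, and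
-- it does not presuppose that `s α` is square integrable.
lemma lintegral_le_sum {s : ∀ α (x : U α), e α x} (α : I)
    (hs : AEMeasurableSection Q (volOn g (U α)) (s α))
    (hc : ∀ β, ∀ᵐ x ∂(vol g), ∀ (hα : x ∈ U α) (hβ : x ∈ U β),
      s α ⟨x, hα⟩ = c.q α β x hα hβ (s β ⟨x, hβ⟩)) :
    ∫⁻ x, ‖s α x‖ₑ ^ 2 ∂(volOn g (U α)) ≤
      (activeIndices P).card * ∑ i ∈ activeIndices P, ∫⁻ x : U (P.idx i),
        ‖P.f i x‖ₑ ^ 2 * ‖s (P.idx i) x‖ₑ ^ 2 ∂(volOn g (U (P.idx i))) := by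
  have := secondCountableTopology_opens n m (U α)
  have := isContinuousRiemannianBundle n m Q (e α)
  have hm : AEMeasurable (fun x => ‖s α x‖ₑ ^ 2) (volOn g (U α)) := by
    simpa using hs.norm.enorm.pow_const 2
  have hf : ∀ i, Measurable fun x : U α => ‖P.f i x‖ₑ ^ 2 := fun i =>
    (((P.f i).contMDiff.continuous.comp continuous_subtype_val).measurable.enorm.pow_const 2)
  calc ∫⁻ x, ‖s α x‖ₑ ^ 2 ∂(volOn g (U α))
      ≤ ∫⁻ x, (activeIndices P).card * ∑ i ∈ activeIndices P, ‖P.f i x‖ₑ ^ 2 * ‖s α x‖ₑ ^ 2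
          ∂(volOn g (U α)) := by
        refine lintegral_mono fun x => ?_
        rw [← Finset.sum_mul, ← mul_assoc]
        refine le_mul_of_one_le_left zero_le ?_
        have h := ENNReal.ofReal_le_ofReal (one_le_card_mul_sum_sq (P := P) (x : V))
        rw [ENNReal.ofReal_one, ENNReal.ofReal_mul (Nat.cast_nonneg _), ENNReal.ofReal_natCast,
          ENNReal.ofReal_sum_of_nonneg fun i _ => sq_nonneg _] at h
        refine h.trans_eq ?_
        congr 1
        refine Finset.sum_congr rfl fun i _ => ?_
        rw [ENNReal.ofReal_pow (P.f.nonneg i x), Real.enorm_of_nonneg (P.f.nonneg i x)]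
    _ = (activeIndices P).card * ∑ i ∈ activeIndices P,
          ∫⁻ x, ‖P.f i x‖ₑ ^ 2 * ‖s α x‖ₑ ^ 2 ∂(volOn g (U α)) := by
        rw [lintegral_const_mul' _ _ (ENNReal.natCast_ne_top _),
          lintegral_finsetSum' (μ := volOn g (U α)) _
            (f := fun i x => ‖P.f i x‖ₑ ^ 2 * ‖s α x‖ₑ ^ 2) fun i _ => (hf i).aemeasurable.mul hm]
    _ ≤ _ := by
        gcongr with i _
        refine lintegral_le_of_compat (f := fun x => ‖P.f i x‖ₑ ^ 2) α (P.idx i) (hc _) fun x hx => ?_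
        have : P.f i x = 0 := by
          by_contra h
          exact hx (P.subordinate i (subset_tsupport _ h))
        simp [this]

lemma IsL2Family.lintegral_le_pairing {s : ∀ α (x : U α), e α x} (hs : IsL2Family c g s) (α : I) :
    ∫⁻ x, ‖s α x‖ₑ ^ 2 ∂(volOn g (U α)) ≤
      (activeIndices P).card * ENNReal.ofReal (pairing g P s s) := by
  rw [ofReal_pairing (hs.integrable hs)]
  exact lintegral_le_sum P α (hs.isL2Section α).aemeasurableSection (hs.compat α)

lemma IsL2Family.pairing_le_lintegral {s : ∀ α (x : U α), e α x} (hs : IsL2Family c g s) :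
    ENNReal.ofReal (pairing g P s s) ≤ ∑ i ∈ activeIndices P,
      ∫⁻ x, ‖s (P.idx i) x‖ₑ ^ 2 ∂(volOn g (U (P.idx i))) := by
  rw [ofReal_pairing (hs.integrable hs)]
  gcongr with i _ x
  refine mul_le_of_le_one_left zero_le (pow_le_one₀ zero_le ?_)
  rw [← ofReal_norm, ← ENNReal.ofReal_one]
  exact ENNReal.ofReal_le_ofReal (partition_norm_le_one P i x)

namespace IsL2Family

variable {s t : ∀ α (x : U α), e α x}

lemma add (hs : IsL2Family c g s) (ht : IsL2Family c g t) : IsL2Family c g (s + t) where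
  isL2Section α := (hs.isL2Section α).add (ht.isL2Section α)
  compat α β := by
    filter_upwards [hs.compat α β, ht.compat α β] with x h1 h2 hα hβ
    simp [h1 hα hβ, h2 hα hβ]

lemma smul (hs : IsL2Family c g s) (r : ℝ) : IsL2Family c g (r • s) where
  isL2Section α := (hs.isL2Section α).smul r
  compat α β := by
    filter_upwards [hs.compat α β] with x h1 hα hβ
    simp [h1 hα hβ]

lemma verPart (hs : IsL2Family c g s) : IsL2Family c g (verPart c s) where
  isL2Section α := (hs.isL2Section α).ver c
  compat α β := by
    filter_upwards [hs.compat α β] with x h1 hα hβ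
    simp only [NGerbe.verPart]
    rw [h1 hα hβ, c.q_ver]

end IsL2Family

/-- A smooth section over the noncompact `U α` could be unbounded. Compatibility excludes infinite
mass: the cut-off integrands have compact support, so the key estimate has a finite right-hand side.
-/
lemma isL2Family_family (z : PreHilbertZ c g P) : IsL2Family c g z.family := by
  have hm : ∀ α, AEMeasurableSection Q (volOn g (U α)) (z.family α) := fun α =>
    AEMeasurableSection.of_continuous (family_smooth z α).continuous
  have hc : ∀ α β, ∀ᵐ x ∂(vol g), ∀ (hα : x ∈ U α) (hβ : x ∈ U β),
      z.family α ⟨x, hα⟩ = c.q α β x hα hβ (z.family β ⟨x, hβ⟩) := fun α β =>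
    ae_of_all _ fun x hα hβ => z.2 α β x hα hβ
  refine ⟨fun α => ⟨hm α, ?_⟩, hc⟩
  refine (lintegral_le_sum P α (hm α) (hc α)).trans_lt ?_
  rw [← ofReal_pairing (integrand_integrable z z)]
  exact ENNReal.mul_lt_top (ENNReal.natCast_lt_top _) ENNReal.ofReal_lt_top

/-! ### The semi-inner product space of compatible `L²` families -/

variable (g c P) in
/-- The compatible families of `L²` sections, with the semidefinite scalar product
`pairing g P`. -/
def L2FamilySpace : Type _ :=
  ({ carrier := {s | IsL2Family c g s}
     add_mem' := IsL2Family.add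
     zero_mem' := isL2Family_family (P := P) (0 : PreHilbertZ c g P)
     smul_mem' := fun r _ hs => IsL2Family.smul hs r } : Submodule ℝ (∀ α (x : U α), e α x))

namespace L2FamilySpace

instance : AddCommGroup (L2FamilySpace g c P) := by unfold L2FamilySpace; infer_instance
instance : Module ℝ (L2FamilySpace g c P) := by unfold L2FamilySpace; infer_instance

/-- The element given by a compatible family of `L²` sections. -/
def of {s : ∀ α (x : U α), e α x} (hs : IsL2Family c g s) : L2FamilySpace g c P := ⟨s, hs⟩

/-- The underlying family of sections. -/
def family (s : L2FamilySpace g c P) : ∀ α (x : U α), e α x := s.1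

lemma isL2Family (s : L2FamilySpace g c P) : IsL2Family c g s.family := s.2

lemma family_add (s t : L2FamilySpace g c P) : (s + t).family = s.family + t.family := rfl
lemma family_sub (s t : L2FamilySpace g c P) : (s - t).family = s.family - t.family := rfl
lemma family_smul (r : ℝ) (s : L2FamilySpace g c P) : (r • s).family = r • s.family := rfl

instance preCore : PreInnerProductSpace.Core ℝ (L2FamilySpace g c P) where
  inner s t := pairing g P s.family t.family
  conj_inner_symm s t := by
    simp only [pairing, conj_trivial]
    exact finsum_congr fun i => integral_congr_ae (ae_of_all _ fun x => real_inner_comm _ _)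
  re_inner_nonneg s := by
    simp only [pairing, RCLike.re_to_real]
    exact finsum_nonneg fun i => integral_nonneg fun x => real_inner_self_nonneg
  add_left s t u := by
    simp only [pairing_eq_sum, ← Finset.sum_add_distrib]
    refine Finset.sum_congr rfl fun i _ => ?_
    rw [← integral_add (s.isL2Family.integrable u.isL2Family i)
      (t.isL2Family.integrable u.isL2Family i)]
    refine integral_congr_ae (ae_of_all _ fun x => ?_)
    simp only [family_add, Pi.add_apply, smul_add, inner_add_left]
  smul_left s t r := by
    simp only [pairing_eq_sum, conj_trivial, Finset.mul_sum]
    refine Finset.sum_congr rfl fun i _ => ?_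
    rw [← integral_const_mul]
    refine integral_congr_ae (ae_of_all _ fun x => ?_)
    simp only [family_smul, Pi.smul_apply, smul_comm _ r, real_inner_smul_left]

/-- Only a seminorm, since families that agree almost everywhere are not yet identified. -/
instance : SeminormedAddCommGroup (L2FamilySpace g c P) :=
  InnerProductSpace.Core.toSeminormedAddCommGroup (𝕜 := ℝ)

instance : InnerProductSpace ℝ (L2FamilySpace g c P) := InnerProductSpace.ofCore preCore

lemma inner_eq (s t : L2FamilySpace g c P) : inner ℝ s t = pairing g P s.family t.family := rfl

lemma enorm_sq (s : L2FamilySpace g c P) :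
    ‖s‖ₑ ^ 2 = ENNReal.ofReal (pairing g P s.family s.family) := by
  rw [← inner_eq, real_inner_self_eq_norm_sq, ENNReal.ofReal_pow (norm_nonneg _), ofReal_norm]

lemma lintegral_le (s : L2FamilySpace g c P) (α : I) :
    ∫⁻ x, ‖s.family α x‖ₑ ^ 2 ∂(volOn g (U α)) ≤ (activeIndices P).card * ‖s‖ₑ ^ 2 := by
  rw [enorm_sq]
  exact s.isL2Family.lintegral_le_pairing α

lemma enorm_sq_le (s : L2FamilySpace g c P) : ‖s‖ₑ ^ 2 ≤ ∑ i ∈ activeIndices P,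
    ∫⁻ x, ‖s.family (P.idx i) x‖ₑ ^ 2 ∂(volOn g (U (P.idx i))) := by
  rw [enorm_sq]
  exact s.isL2Family.pairing_le_lintegral

lemma aemeasurable_enorm (s : L2FamilySpace g c P) (α : I) :
    AEMeasurable (fun x => ‖s.family α x‖ₑ) (volOn g (U α)) := by
  simpa using (s.isL2Family.isL2Section α).memLp_norm.1.enorm

lemma aeEq_of_norm_sub_eq_zero {s t : L2FamilySpace g c P} (h : ‖s - t‖ = 0) :
    AEEq g s.family t.family := by
  intro α
  have h0 := lintegral_le (s - t) α
  rw [← ofReal_norm, h, ENNReal.ofReal_zero, zero_pow two_ne_zero, mul_zero,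
    nonpos_iff_eq_zero, lintegral_eq_zero_iff' ((aemeasurable_enorm (s - t) α).pow_const 2)] at h0
  filter_upwards [h0] with x hx
  simpa [family_sub, sub_eq_zero] using hx

end L2FamilySpace

lemma pairing_congr {s s' t t' : ∀ α (x : U α), e α x} (hs : AEEq g s s') (ht : AEEq g t t') :
    pairing g P s t = pairing g P s' t' := by
  rw [pairing_eq_sum, pairing_eq_sum]
  refine Finset.sum_congr rfl fun i _ => ?_
  refine integral_congr_ae ?_
  filter_upwards [hs (P.idx i), ht (P.idx i)] with x h1 h2
  simp only [h1, h2]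

/-! ### Completeness of the space of families -/

/-- If the weighted sum is `M`, each increment has norm at most `√M / 2 ^ k`, so the sequence is
Cauchy. -/
lemma exists_tendsto_of_tsum_ne_top {E : Type*} [NormedAddCommGroup E] [CompleteSpace E]
    {u : ℕ → E} (h : ∑' k, (4 : ℝ≥0∞) ^ k * ‖u (k + 1) - u k‖ₑ ^ 2 ≠ ⊤) :
    ∃ y, Tendsto u atTop (𝓝 y) := by
  set M := ∑' k, (4 : ℝ≥0∞) ^ k * ‖u (k + 1) - u k‖ₑ ^ 2 with hM
  refine cauchySeq_tendsto_of_complete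
    (cauchySeq_of_le_geometric (1 / 2) (√M.toReal) (by norm_num) fun k => ?_)
  have h1 := ENNReal.toReal_mono h
    (ENNReal.le_tsum (f := fun k => (4 : ℝ≥0∞) ^ k * ‖u (k + 1) - u k‖ₑ ^ 2) k)
  simp only [ENNReal.toReal_mul, ENNReal.toReal_pow, toReal_enorm, ENNReal.toReal_ofNat] at h1
  have h2 : (2 ^ k * ‖u (k + 1) - u k‖) ^ 2 ≤ M.toReal := by
    rw [mul_pow, ← pow_mul, mul_comm k 2, pow_mul]
    norm_num
    exact h1
  have h3 := Real.le_sqrt_of_sq_le h2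
  rw [dist_comm, dist_eq_norm, one_div, inv_pow, ← div_eq_mul_inv, le_div_iff₀ (by positivity),
    mul_comm]
  exact h3

namespace L2FamilySpace

/-- The squared increments have mass at most a constant times `16⁻¹ ^ k`. Weighted by `4 ^ k` they
are still summable, so the weighted sum is finite at almost every point. -/
lemma ae_exists_tendsto {u : ℕ → L2FamilySpace g c P}
    (hu : ∀ k, ‖u (k + 1) - u k‖ₑ ≤ 4⁻¹ ^ k) (α : I) :
    ∀ᵐ x ∂(volOn g (U α)), ∃ y, Tendsto (fun k => (u k).family α x) atTop (𝓝 y) := by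
  have hm : ∀ k, AEMeasurable (fun x => (4 : ℝ≥0∞) ^ k *
      ‖(u (k + 1) - u k).family α x‖ₑ ^ 2) (volOn g (U α)) := fun k =>
    ((aemeasurable_enorm (u (k + 1) - u k) α).pow_const 2).const_mul _
  have hfin : ∫⁻ x, ∑' k, (4 : ℝ≥0∞) ^ k * ‖(u (k + 1) - u k).family α x‖ₑ ^ 2
      ∂(volOn g (U α)) ≠ ⊤ := by
    rw [lintegral_tsum hm]
    have hle : ∀ k, ∫⁻ x, (4 : ℝ≥0∞) ^ k * ‖(u (k + 1) - u k).family α x‖ₑ ^ 2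
        ∂(volOn g (U α)) ≤ (activeIndices P).card * 4⁻¹ ^ k := by
      intro k
      rw [lintegral_const_mul' _ _ (by finiteness)]
      calc (4 : ℝ≥0∞) ^ k * ∫⁻ x, ‖(u (k + 1) - u k).family α x‖ₑ ^ 2 ∂(volOn g (U α))
          ≤ 4 ^ k * ((activeIndices P).card * (4⁻¹ ^ k) ^ 2) := by
            gcongr
            refine (lintegral_le _ α).trans ?_
            gcongr
            exact hu k
        _ = (activeIndices P).card * ((4 * 4⁻¹) ^ k * 4⁻¹ ^ k) := by
            rw [mul_pow]; ring
        _ = _ := by rw [ENNReal.mul_inv_cancel (by norm_num) (by norm_num), one_pow, one_mul]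
    refine ne_top_of_le_ne_top ?_ (ENNReal.tsum_le_tsum hle)
    rw [ENNReal.tsum_mul_left, ENNReal.tsum_geometric]
    refine ENNReal.mul_ne_top (ENNReal.natCast_ne_top _) (ENNReal.inv_ne_top.2 ?_)
    rw [← pos_iff_ne_zero, tsub_pos_iff_lt]
    exact ENNReal.inv_lt_one.2 (by norm_num)
  filter_upwards [ae_lt_top' (AEMeasurable.tsum hm) hfin] with x hx
  have := completeSpace_fiber (F := Q) (E := e α) (mem_baseSet_trivializationAt Q (e α) x)
  exact exists_tendsto_of_tsum_ne_top (by simpa [family_sub] using hx.ne)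

instance : CompleteSpace (L2FamilySpace g c P) := by
  refine EMetric.complete_of_convergent_controlled_sequences (fun k => 4⁻¹ ^ k)
    (fun k => ENNReal.pow_pos (by simp) k) fun u hu => ?_
  have hu' : ∀ N k l, N ≤ k → N ≤ l → ‖u k - u l‖ₑ ≤ 4⁻¹ ^ N := fun N k l hk hl => by
    rw [← edist_eq_enorm_sub]
    exact (hu N k l hk hl).le
  have hae := ae_exists_tendsto fun k => hu' k (k + 1) k k.le_succ le_rfl
  -- Where the limit does not exist, on a null set, the value is arbitrary.
  let s : ∀ α (x : U α), e α x := fun α x => limUnder atTop fun k => (u k).family α x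
  have hlim : ∀ α, ∀ᵐ x ∂(volOn g (U α)), Tendsto (fun k => (u k).family α x) atTop (𝓝 (s α x)) :=
    fun α => (hae α).mono fun x hx => tendsto_nhds_limUnder hx
  have hdist : ∀ k α, ∫⁻ x, ‖s α x - (u k).family α x‖ₑ ^ 2 ∂(volOn g (U α)) ≤
      (activeIndices P).card * (4⁻¹ ^ k) ^ 2 := by
    intro k α
    -- Fatou's lemma for `l → ∞` with `k` fixed.
    have h1 : ∀ᵐ x ∂(volOn g (U α)), ‖s α x - (u k).family α x‖ₑ ^ 2 =
        liminf (fun l => ‖(u l - u k).family α x‖ₑ ^ 2) atTop := by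
      filter_upwards [hlim α] with x hx
      exact ((ENNReal.continuous_pow 2).tendsto _ |>.comp
        ((hx.sub_const ((u k).family α x)).enorm)).liminf_eq.symm
    rw [lintegral_congr_ae h1]
    refine (lintegral_liminf_le' fun l =>
      (aemeasurable_enorm (u l - u k) α).pow_const 2).trans ?_
    refine liminf_le_of_frequently_le' (Eventually.frequently ?_)
    filter_upwards [eventually_ge_atTop k] with l hl
    refine (lintegral_le _ α).trans ?_
    gcongr
    exact hu' k l k hl le_rfl
  have hs : IsL2Family c g s := by
    have hsec : ∀ α, AEMeasurableSection Q (volOn g (U α)) (s α) := fun α =>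
      AEMeasurableSection.of_tendsto (fun k => ((u k).isL2Family.isL2Section α).aemeasurableSection)
        (hlim α)
    constructor
    · intro α
      -- The limit lies at finite distance from `u 0`, hence is square integrable.
      have h0 : IsL2Section (Q := Q) g α fun x => s α x - (u 0).family α x :=
        ⟨(hsec α).sub ((u 0).isL2Family.isL2Section α).aemeasurableSection,
          (hdist 0 α).trans_lt (by finiteness)⟩
      simpa using h0.add ((u 0).isL2Family.isL2Section α)
    · intro α β
      have hc := ae_all_iff.2 fun k => (u k).isL2Family.compat α β
      have hα := ae_volOn_iff (p := fun x => Tendsto (fun k => (u k).family α x) atTop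
        (𝓝 (s α x))) |>.1 (hlim α)
      have hβ := ae_volOn_iff (p := fun x => Tendsto (fun k => (u k).family β x) atTop
        (𝓝 (s β x))) |>.1 (hlim β)
      filter_upwards [hc, hα, hβ] with x h1 h2 h3 hxα hxβ
      refine tendsto_nhds_unique (h2 hxα) ?_
      simp only [h1 _ hxα hxβ]
      exact ((c.q α β x hxα hxβ).continuous.tendsto _).comp (h3 hxβ)
  let S : L2FamilySpace g c P := of hs
  refine ⟨S, tendsto_iff_edist_tendsto_0.2 ?_⟩
  -- One factor comes from the number of summands in `enorm_sq_le`, the other from the bound `hdist`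
  -- on each.
  have hsq : ∀ k, edist (u k) S ^ 2 ≤
      (activeIndices P).card * ((activeIndices P).card * (4⁻¹ ^ k) ^ 2) := by
    intro k
    rw [edist_comm, edist_eq_enorm_sub]
    refine (enorm_sq_le _).trans ((Finset.sum_le_card_nsmul _ _ _ fun i _ =>
      hdist k (P.idx i)).trans_eq ?_)
    rw [nsmul_eq_mul]
  have h4 : Tendsto (fun k : ℕ => (activeIndices P).card *
      ((activeIndices P).card * ((4⁻¹ : ℝ≥0∞) ^ k) ^ 2)) atTop (𝓝 0) := by
    have h5 : Tendsto (fun k : ℕ => ((4⁻¹ : ℝ≥0∞) ^ k) ^ 2) atTop (𝓝 0) := by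
      simpa [Function.comp_def] using (ENNReal.continuous_pow 2).tendsto 0 |>.comp
        (ENNReal.tendsto_pow_atTop_nhds_zero_of_lt_one (ENNReal.inv_lt_one.2 (by norm_num)))
    simpa using ENNReal.Tendsto.const_mul (ENNReal.Tendsto.const_mul h5
      (Or.inr (ENNReal.natCast_ne_top (activeIndices P).card)))
      (Or.inr (ENNReal.natCast_ne_top (activeIndices P).card))
  have h6 := tendsto_of_tendsto_of_tendsto_of_le_of_le tendsto_const_nhds h4 (fun _ => zero_le) hsq
  -- Square roots turn convergence of squared distances into convergence of distances.
  have h7 := (ENNReal.continuous_rpow_const (y := ((2 : ℕ) : ℝ)⁻¹)).tendsto 0 |>.comp h6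
  rw [ENNReal.zero_rpow_of_pos (by norm_num)] at h7
  exact h7.congr fun k => ENNReal.pow_rpow_inv_natCast two_ne_zero _

end L2FamilySpace

/-! ### The h-v-splitting and the quotient by null families -/

/-- The integrand vanishes at every point, so neither measurability nor integrability of the
families matters. -/
lemma pairing_horPart_verPart (s t : ∀ α (x : U α), e α x) :
    pairing g P (horPart c s) (verPart c t) = 0 := by
  rw [pairing_eq_sum]
  refine Finset.sum_eq_zero fun i _ => integral_eq_zero_of_ae (ae_of_all _ fun x => ?_)
  simp only [horPart, verPart, real_inner_smul_left, real_inner_smul_right, Pi.zero_apply]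
  rw [← c.ver_symm, map_sub, c.ver_idem, sub_self, inner_zero_left, mul_zero, mul_zero]

namespace L2FamilySpace

lemma norm_sub_eq_zero_iff {s t : L2FamilySpace g c P} :
    ‖s - t‖ = 0 ↔ AEEq g s.family t.family := by
  refine ⟨aeEq_of_norm_sub_eq_zero, fun h => ?_⟩
  have h0 : AEEq g (s - t).family (0 : L2FamilySpace g c P).family := fun α =>
    (h α).mono fun x hx => sub_eq_zero.2 hx
  have h1 : inner ℝ (s - t) (s - t) = (0 : ℝ) := by
    rw [inner_eq, pairing_congr h0 h0, ← inner_eq, inner_zero_left]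
  rwa [real_inner_self_eq_norm_sq, sq_eq_zero_iff] at h1

/-- Thus the separation quotient is the space of families modulo equality almost everywhere. -/
lemma mk_eq_mk_iff {s t : L2FamilySpace g c P} :
    SeparationQuotient.mk s = SeparationQuotient.mk t ↔ AEEq g s.family t.family := by
  rw [SeparationQuotient.mk_eq_mk, Metric.inseparable_iff, dist_eq_norm, norm_sub_eq_zero_iff]

variable (g c P) in
/-- The inclusion of the smooth global sections into the compatible families of `L²` sections. -/
def ofSmooth : PreHilbertZ c g P →ₗᵢ[ℝ] L2FamilySpace g c P where
  toFun z := of (isL2Family_family z)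
  map_add' _ _ := rfl
  map_smul' _ _ := rfl
  norm_map' _ := rfl

variable (g c P) in
/-- The vertical projection of families. -/
def ver : L2FamilySpace g c P →L[ℝ] L2FamilySpace g c P :=
  LinearMap.mkContinuous
    { toFun := fun s => of s.isL2Family.verPart
      map_add' := fun s t => Subtype.ext <| funext fun α => funext fun x => map_add _ _ _
      map_smul' := fun r s => Subtype.ext <| funext fun α => funext fun x => map_smul _ _ _ } 1
    fun s => by
      set v : L2FamilySpace g c P := of s.isL2Family.verPart with hv
      -- Pythagoras for `s = (s - v) + v` gives the operator bound 1.
      have h0 : inner ℝ (s - v) v = (0 : ℝ) := pairing_horPart_verPart _ _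
      have h1 := norm_add_sq_eq_norm_sq_add_norm_sq_of_inner_eq_zero _ _ h0
      rw [sub_add_cancel] at h1
      rw [one_mul]
      change ‖v‖ ≤ ‖s‖
      nlinarith [norm_nonneg v, norm_nonneg s, mul_self_nonneg ‖s - v‖]

lemma family_ver (s : L2FamilySpace g c P) : (ver g c P s).family = verPart c s.family := rfl

lemma norm_ver_le (s : L2FamilySpace g c P) : ‖ver g c P s‖ ≤ ‖s‖ := by
  simpa using (ver g c P).le_of_opNorm_le (LinearMap.mkContinuous_norm_le _ zero_le_one _) s

end L2FamilySpace

open L2FamilySpace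

variable (g c P) in
/-- The vertical projection of smooth global sections. -/
def PreHilbertZ.ver : PreHilbertZ c g P →L[ℝ] PreHilbertZ c g P :=
  LinearMap.mkContinuous
    { toFun := fun z => ⟨fun α => ⟨fun x => c.ver α x (z.family α x),
          (c.ver_smooth α).comp (family_smooth z α)⟩, fun α β x hα hβ => by
          have h : z.family α ⟨x, hα⟩ = c.q α β x hα hβ (z.family β ⟨x, hβ⟩) := z.2 α β x hα hβ
          change c.ver α ⟨x, hα⟩ (z.family α ⟨x, hα⟩) =
            c.q α β x hα hβ (c.ver β ⟨x, hβ⟩ (z.family β ⟨x, hβ⟩))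
          rw [h, c.q_ver]⟩
      map_add' := fun z w => Subtype.ext <| funext fun α => ContMDiffSection.ext fun x =>
        map_add (c.ver α x) (z.family α x) (w.family α x)
      map_smul' := fun r z => Subtype.ext <| funext fun α => ContMDiffSection.ext fun x =>
        map_smul (c.ver α x) r (z.family α x) } 1
    fun z => by
      rw [one_mul]
      -- The bound is inherited through the isometric inclusion `ofSmooth`.
      exact norm_ver_le (ofSmooth g c P z)

lemma ofSmooth_ver (z : PreHilbertZ c g P) :
    ofSmooth g c P (PreHilbertZ.ver g c P z) = L2FamilySpace.ver g c P (ofSmooth g c P z) := rfl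

/-! ### Extension to the Hilbert completion -/

lemma denseRange_coe : DenseRange
    (UniformSpace.Completion.toComplL : PreHilbertZ c g P →L[ℝ] L2Z c g P) :=
  UniformSpace.Completion.denseRange_coe

lemma isUniformInducing_coe : IsUniformInducing
    (UniformSpace.Completion.toComplL : PreHilbertZ c g P →L[ℝ] L2Z c g P) :=
  UniformSpace.Completion.isUniformInducing_coe _

variable (g c P) in
/-- The extension of the inclusion `ofSmooth` to the completion, modulo equality almost
everywhere. -/
def realizationClass : L2Z c g P →L[ℝ] SeparationQuotient (L2FamilySpace g c P) :=
  -- The quotient is Hausdorff as well as complete, so the extension by density is unique.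
  ((SeparationQuotient.mkCLM ℝ (L2FamilySpace g c P)).comp
    (ofSmooth g c P).toContinuousLinearMap).extend UniformSpace.Completion.toComplL

lemma realizationClass_coe (z : PreHilbertZ c g P) :
    realizationClass g c P (z : L2Z c g P) = SeparationQuotient.mk (ofSmooth g c P z) :=
  ContinuousLinearMap.extend_eq _ denseRange_coe isUniformInducing_coe z

lemma inner_realizationClass (ζ η : L2Z c g P) :
    inner ℝ (realizationClass g c P ζ) (realizationClass g c P η) = (inner ℝ ζ η : ℝ) := by
  induction ζ, η using UniformSpace.Completion.induction_on₂ with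
  | hp => exact isClosed_eq (by fun_prop) (by fun_prop)
  | ih z w =>
    rw [realizationClass_coe, realizationClass_coe, SeparationQuotient.inner_mk_mk,
      UniformSpace.Completion.inner_coe]
    rfl

variable (g c P) in
/-- A representative of `realizationClass`. -/
def realize : L2Z c g P →L[ℝ] L2FamilySpace g c P :=
  -- `outCLM` is a continuous linear right inverse of the quotient map, so the representatives are
  -- linear in `ζ` at every point, not only almost everywhere.
  (SeparationQuotient.outCLM ℝ (L2FamilySpace g c P)).comp (realizationClass g c P)

lemma mk_realize (ζ : L2Z c g P) :
    SeparationQuotient.mk (realize g c P ζ) = realizationClass g c P ζ :=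
  SeparationQuotient.mk_outCLM ℝ _

lemma inner_realize (ζ η : L2Z c g P) :
    (inner ℝ ζ η : ℝ) = pairing g P (realize g c P ζ).family (realize g c P η).family := by
  rw [← L2FamilySpace.inner_eq, ← SeparationQuotient.inner_mk_mk (realize g c P ζ), mk_realize,
    mk_realize, inner_realizationClass]

lemma isRealization_realize : IsRealization c g P fun ζ => (realize g c P ζ).family where
  isL2Family ζ := (realize g c P ζ).isL2Family
  coe z := (mk_eq_mk_iff (t := ofSmooth g c P z)).1 (by rw [mk_realize, realizationClass_coe])
  add ζ η α := ae_of_all _ fun x => by rw [map_add]; rfl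
  smul r ζ α := ae_of_all _ fun x => by rw [map_smul]; rfl
  inner := inner_realize

/-! ### N-adaptedness -/

variable (g c P) in
/-- The vertical projection of the Hilbert completion. -/
def L2Z.ver : L2Z c g P →L[ℝ] L2Z c g P := (PreHilbertZ.ver g c P).completion

/-- Equality almost everywhere is the vanishing of a seminorm that is continuous in `ζ`, so it
suffices to check smooth sections. -/
lemma realize_ver (ζ : L2Z c g P) :
    AEEq g (realize g c P (L2Z.ver g c P ζ)).family
      (verPart c (realize g c P ζ).family) := by
  rw [← family_ver, ← L2FamilySpace.norm_sub_eq_zero_iff]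
  induction ζ using UniformSpace.Completion.induction_on with
  | hp => exact isClosed_eq (by fun_prop) continuous_const
  | ih z =>
    -- On smooth sections the chosen representative agrees with the section only up to norm zero;
    -- the calculation below carries both such errors.
    have h : ∀ w : PreHilbertZ c g P, ‖realize g c P (w : L2Z c g P) - ofSmooth g c P w‖ = 0 :=
      fun w => L2FamilySpace.norm_sub_eq_zero_iff.2 (isRealization_realize.coe w)
    rw [L2Z.ver, ContinuousLinearMap.completion_apply_coe]
    refine le_antisymm ?_ (norm_nonneg _)
    calc _ = ‖(realize g c P (PreHilbertZ.ver g c P z : L2Z c g P) -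
              ofSmooth g c P (PreHilbertZ.ver g c P z)) -
            L2FamilySpace.ver g c P (realize g c P (z : L2Z c g P) - ofSmooth g c P z)‖ := by
          rw [ofSmooth_ver, map_sub]; congr 1; abel
      _ ≤ 0 + 0 := (norm_sub_le _ _).trans
          (add_le_add (h _).le ((norm_ver_le _).trans (h z).le))
      _ = 0 := add_zero 0

lemma realize_hor (ζ : L2Z c g P) :
    AEEq g (realize g c P (ζ - L2Z.ver g c P ζ)).family
      (horPart c (realize g c P ζ).family) := by
  intro α
  filter_upwards [realize_ver ζ α] with x hx
  rw [map_sub, family_sub]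
  exact congrArg ((realize g c P ζ).family α x - ·) hx

lemma inner_sub_ver_ver (ζ η : L2Z c g P) :
    inner ℝ (ζ - L2Z.ver g c P ζ) (L2Z.ver g c P η) = (0 : ℝ) := by
  rw [inner_realize, pairing_congr (P := P) (realize_hor ζ) (realize_ver η)]
  exact pairing_horPart_verPart _ _

lemma inner_eq_pairing_horPart_add_pairing_verPart (ζ η : L2Z c g P) :
    (inner ℝ ζ η : ℝ) =
      pairing g P (horPart c (realize g c P ζ).family) (horPart c (realize g c P η).family) +
      pairing g P (verPart c (realize g c P ζ).family) (verPart c (realize g c P η).family) := by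
  have h1 := inner_sub_ver_ver ζ η
  have h2 := inner_sub_ver_ver η ζ
  have h3 := pairing_congr (P := P) (realize_hor ζ) (realize_hor η)
  have h4 := pairing_congr (P := P) (realize_ver ζ) (realize_ver η)
  -- Both pairings become scalar products in the completion, where the cross terms vanish by `h1`
  -- and `h2`.
  rw [← h3, ← h4, ← inner_realize, ← inner_realize]
  rw [real_inner_comm] at h2
  simp only [inner_sub_left, inner_sub_right] at h1 h2 ⊢
  linarith

lemma isNAdapted_realize : IsNAdapted c g P fun ζ => (realize g c P ζ).family := by
  have happ : ∀ ζ : L2Z c g P, (ContinuousLinearMap.id ℝ (L2Z c g P) - L2Z.ver g c P) ζ =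
      ζ - L2Z.ver g c P ζ := fun ζ => sub_apply _ _ ζ
  refine ⟨⟨ContinuousLinearMap.id ℝ _ - L2Z.ver g c P, L2Z.ver g c P, fun ζ => ?_, fun ζ η => ?_,
    fun ζ => ?_, realize_ver⟩, inner_eq_pairing_horPart_add_pairing_verPart⟩
  · rw [happ, sub_add_cancel]
  · rw [happ, inner_sub_ver_ver]
  · rw [happ]
    exact realize_hor ζ

/-! ### Uniqueness of the realization -/

/-- A realization as an isometry into the families modulo equality almost everywhere. -/
def IsRealization.toLinearIsometry {T : L2Z c g P → ∀ α (x : U α), e α x}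
    (hT : IsRealization c g P T) : L2Z c g P →ₗᵢ[ℝ] SeparationQuotient (L2FamilySpace g c P) where
  toFun ζ := SeparationQuotient.mk (of (P := P) (hT.isL2Family ζ))
  map_add' ζ η := by
    rw [← SeparationQuotient.mk_add]
    exact mk_eq_mk_iff.2 (hT.add ζ η)
  map_smul' r ζ := by
    rw [RingHom.id_apply, ← SeparationQuotient.mk_smul]
    exact mk_eq_mk_iff.2 (hT.smul r ζ)
  norm_map' ζ := by
    refine (pow_left_inj₀ (norm_nonneg _) (norm_nonneg _) two_ne_zero).1 ?_
    rw [← real_inner_self_eq_norm_sq, ← real_inner_self_eq_norm_sq, hT.inner]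
    rfl

/-- Continuity is not demanded of a realization, but it follows from preservation of the scalar
product; two realizations that agree on the dense subspace `Z(q)` therefore agree. -/
lemma IsRealization.unique {T T' : L2Z c g P → ∀ α (x : U α), e α x}
    (hT : IsRealization c g P T) (hT' : IsRealization c g P T') (ζ : L2Z c g P) :
    AEEq g (T' ζ) (T ζ) := by
  have h : (hT'.toLinearIsometry : L2Z c g P → _) = hT.toLinearIsometry := by
    refine denseRange_coe.equalizer hT'.toLinearIsometry.continuous
      hT.toLinearIsometry.continuous (funext fun z => mk_eq_mk_iff.2 fun α => ?_)
    filter_upwards [hT.coe z α, hT'.coe z α] with x h1 h2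
    exact h2.trans h1.symm
  exact mk_eq_mk_iff.1 (congrFun h ζ)

end Families
end NGerbe
end

theorem mainTheorem8
    -- the compact manifold with N-connection and d-metric
    {n m : ℕ} {V : Type*} [TopologicalSpace V] [T2Space V] [CompactSpace V]
    [ChartedSpace (NGerbe.Coord n m) V] [IsManifold 𝓘(ℝ, NGerbe.Coord n m) ∞ V]
    [MeasurableSpace V] [BorelSpace V]
    {N : NGerbe.NConnection n m V} (g : NGerbe.DMetric N)
    -- the Riemannian vector bundles over the open sets of the covering
    {Q : Type*} [NormedAddCommGroup Q] [NormedSpace ℝ Q] [FiniteDimensional ℝ Q]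
    {I : Type*} {U : I → Opens V}
    {e : ∀ α, U α → Type*} [∀ α, TopologicalSpace (TotalSpace Q (e α))]
    [∀ α x, NormedAddCommGroup (e α x)] [∀ α x, InnerProductSpace ℝ (e α x)]
    [∀ α, FiberBundle Q (e α)] [∀ α, VectorBundle ℝ Q (e α)]
    [∀ α, ContMDiffVectorBundle ∞ Q (e α) 𝓘(ℝ, NGerbe.Coord n m)]
    [∀ α, IsContMDiffRiemannianBundle 𝓘(ℝ, NGerbe.Coord n m) ∞ Q (e α)]
    -- the chain of morphisms and the subordinate partition of unity
    (c : NGerbe.DChain n m Q U e)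
    {I' : Type*} (P : NGerbe.SubordinatePartition n m U I') :
    ∃ T : NGerbe.L2Z c g P → ∀ α (x : U α), e α x,
      NGerbe.IsRealization c g P T ∧ NGerbe.IsNAdapted c g P T ∧
      ∀ T' : NGerbe.L2Z c g P → ∀ α (x : U α), e α x, NGerbe.IsRealization c g P T' →
        ∀ ζ, NGerbe.AEEq g (T' ζ) (T ζ) := by
  exact ⟨fun ζ => (NGerbe.realize g c P ζ).family, NGerbe.isRealization_realize,
    NGerbe.isNAdapted_realize, fun _ hT ζ => NGerbe.isRealization_realize.unique hT ζ⟩
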